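/- Let $R$ be a commutative ring with unit, and let $B$ be a finite Boolean lattice of rank $r\ge 0$ (a poset isomorphic to the lattice of subsets of an $r$-element set) with a fixed ordering $a_1,\dots,a_r$ of its atoms. Write $1$ for the greatest element of $B$, $\mathrm{rk}(x)$ for the number of atoms below $x$, and $x<_c y$ when $y$ covers $x$. Let $F$ be a colouring of $B$, i.e. a covariant functor from the poset $B$ to $R$-modules, with maps $F_x^y:F(x)\to F(y)$ for $x\le y$. If $x<_c y$, so that $y=x\vee a_\ell$ with $a_\ell\not\le x$, put $\varepsilon(x<_c y)=(-1)^j$, where $j$ is the number of atoms $a_i\le y$ with $i<\ell$. For a saturated sequence $\mathbf x=(x_1<_c\cdots<_c x_m)$ put $\varepsilon_{\mathbf x}=\prod_i\varepsilon(x_i<_c x_{i+1})$. The cube complex $\mathcal K_*(B,F)$ has $\mathcal K_n=\bigoplus_{\mathrm{rk}(x)=r-n}F(x)$ and differential $d(\lambda)=\sum_{y:\,x<_c y}\varepsilon(x<_c y)\,F_x^y(\lambda)$ for $\lambda\in F(x)$. Its homology is denoted $H^\diamond_n(B,F)$. The complex $\mathcal S_*(B,F)$ has $\mathcal S_0=F(1)$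 and, for $k>0$, $\mathcal S_k=\bigoplus F(x_1)$, the sum over all multi-sequences $x_1\le\cdots\le x_k$ in $B\setminus\{1\}$. An element $\lambda\in F(x_1)$ in the summand of $x_1\le\cdots\le x_k$ is written $\lambda\,x_1\cdots x_k$. The differential is $$d(\lambda\,x_1\cdots x_k)=F_{x_1}^{x_2}(\lambda)\,x_2\cdots x_k-\sum_{i=2}^k(-1)^i\lambda\,x_1\cdots\widehat{x_i}\cdots x_k\quad(k>1),\qquad d(\lambda\,x)=F_x^1(\lambda).$$ The coloured poset homology is $H_n(B,F)=H_n(\mathcal S_*(B,F))$. The reduced complex $\mathcal C_*(B,F)\subseteq\mathcal S_*(B,F)$ is the subcomplex formed by $\mathcal S_0$ and the summands of the strict sequences $x_1<\cdots<x_k$. For $\lambda\in F(x)$ with $\mathrm{rk}(x)=r-n$ define $\phi(\lambda)\in\mathcal C_n(B,F)$ by $$\phi(\lambda)=\sum_{\mathbf x}\varepsilon_{\mathbf x}\,\lambda\,\mathbf x^\circ ,$$ the sum over all saturated sequences $\mathbf x=(x=x_1<_c\cdots<_c x_{n+1}=1)$ from $x$ to $1$, where $\mathbf x^\circ=(x_1<_c\cdots<_c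 x_n)$. **Theorem.** The map $\phi:\mathcal K_*(B,F)\to\mathcal C_*(B,F)$ is a chain map and a quasi-isomorphism. Moreover, for every $n$, the composite of $\phi$ with the inclusion $\mathcal C_*(B,F)\subseteq\mathcal S_*(B,F)$ induces an isomorphism $H^\diamond_n(B,F)\cong H_n(B,F)$. -/

import Mathlib

open CategoryTheory DirectSum

universe u v w

namespace ColouredPoset

/-! ### Complexes of a coloured poset

A coloured poset over `R` is a poset `P` with greatest element `1 = ⊤` and a functor
`F : P ⥤ ModuleCat R`. -/

section Complexes

/-- Cancellation in a double alternating sum. -/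
lemma alternating_sum_eq_zero {M : Type*} [AddCommGroup M] {n : ℕ}
    (f : Fin (n + 2) → Fin (n + 1) → M)
    (hf : ∀ i j : Fin (n + 1), i ≤ j → f j.succ i = f i.castSucc j) :
    ∑ p : Fin (n + 2) × Fin (n + 1),
      ((-1 : ℤ) ^ (p.1 : ℕ) * (-1 : ℤ) ^ (p.2 : ℕ)) • f p.1 p.2 = 0 := by
  let S : Finset (Fin (n + 2) × Fin (n + 1)) := {p | (p.1 : ℕ) ≤ (p.2 : ℕ)}
  rw [← Finset.sum_add_sum_compl S, ← eq_neg_iff_add_eq_zero, ← Finset.sum_neg_distrib]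
  let g : ∀ p : Fin (n + 2) × Fin (n + 1), p ∈ S → Fin (n + 2) × Fin (n + 1) := fun p hp =>
    (p.2.succ, Fin.castLT p.1 (lt_of_le_of_lt (Finset.mem_filter.mp hp).right p.2.is_lt))
  refine Finset.sum_bij g ?_ ?_ ?_ ?_
  · rintro ⟨i, j⟩ hp
    simp_rw [S, g, Finset.compl_filter, Finset.mem_filter_univ, Fin.val_succ,
      Fin.val_castLT] at hp ⊢
    lia
  · rintro ⟨i, j⟩ hp ⟨i', j'⟩ hp' h
    simp only [g, Prod.mk.injEq, Fin.ext_iff, Fin.val_succ, Fin.val_castLT] at h ⊢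
    lia
  · rintro ⟨i, j⟩ hp
    simp_rw [S, Finset.compl_filter, Finset.mem_filter_univ, not_le] at hp
    refine ⟨(Fin.castSucc j, i.pred ?_), ?_, ?_⟩
    · rintro rfl
      simp at hp
    · simpa [S] using! Nat.le_sub_one_of_lt hp
    · simp [g]
  · rintro ⟨i, j⟩ hp
    have hij : (i : ℕ) ≤ j := by simpa [S] using hp
    have hi : (i : ℕ) < n + 1 := lt_of_le_of_lt hij j.is_lt
    have h := hf (Fin.castLT i hi) j hij
    simp only [Fin.castSucc_castLT] at h
    simp only [g, h, ← neg_smul, Fin.val_succ, Fin.val_castLT]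
    congr 1
    ring

/-- Ordered multi-sequences `x₁ ≤ x₂ ≤ ⋯ ≤ x_k` in `P ∖ 1`, where `1 = ⊤` (with `x_{i+1}` written
`seq i` for `i : Fin k`). -/
@[ext]
structure MultiSeq (P : Type u) [PartialOrder P] [OrderTop P] (k : ℕ) : Type u where
  seq : Fin k → P
  monotone : Monotone seq
  ne_top : ∀ i, seq i ≠ ⊤

/-- Ordered sequences `x₁ < x₂ < ⋯ < x_k` in `P ∖ 1`. -/
@[ext]
structure StrictSeq (P : Type u) [PartialOrder P] [OrderTop P] (k : ℕ) : Type u extends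
    MultiSeq P k where
  strictMono : StrictMono seq

variable {P : Type u} [PartialOrder P] [OrderTop P]

/-- The element `x₁` whose colour labels the multi-sequence `x₁ ≤ ⋯ ≤ x_k`; for the empty
multi-sequence (`k = 0`) it is `1`. -/
def MultiSeq.head : {k : ℕ} → MultiSeq P k → P
  | 0, _ => ⊤
  | _ + 1, x => x.seq 0

/-- Delete one term of a multi-sequence. -/
def MultiSeq.face {k : ℕ} (x : MultiSeq P (k + 1)) (i : Fin (k + 1)) : MultiSeq P k where
  seq := x.seq ∘ i.succAbove
  monotone := x.monotone.comp (Fin.strictMono_succAbove i).monotone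
  ne_top _ := x.ne_top _

/-- Delete one term of an ordered sequence. -/
def StrictSeq.face {k : ℕ} (x : StrictSeq P (k + 1)) (i : Fin (k + 1)) : StrictSeq P k where
  toMultiSeq := x.toMultiSeq.face i
  strictMono := x.strictMono.comp (Fin.strictMono_succAbove i)

/-- Deleting a term can only increase the head. -/
lemma MultiSeq.head_le_head_face {k : ℕ} (x : MultiSeq P (k + 1)) (i : Fin (k + 1)) :
    x.head ≤ (x.face i).head := by
  cases k with
  | zero => exact le_top
  | succ k => exact x.monotone (Fin.zero_le _)

lemma MultiSeq.face_face {k : ℕ} (x : MultiSeq P (k + 2)) {i j : Fin (k + 1)} (h : i ≤ j) :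
    (x.face j.succ).face i = (x.face i.castSucc).face j := by
  apply MultiSeq.ext
  funext l
  refine congrArg x.seq ?_
  ext
  dsimp [Fin.succAbove]
  rcases i with ⟨i, _⟩
  rcases j with ⟨j, _⟩
  rcases l with ⟨l, _⟩
  split_ifs <;> · simp at * <;> lia

lemma StrictSeq.head_le_head_face {k : ℕ} (x : StrictSeq P (k + 1)) (i : Fin (k + 1)) :
    x.toMultiSeq.head ≤ (x.face i).toMultiSeq.head :=
  x.toMultiSeq.head_le_head_face i

lemma StrictSeq.face_face {k : ℕ} (x : StrictSeq P (k + 2)) {i j : Fin (k + 1)} (h : i ≤ j) :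
    (x.face j.succ).face i = (x.face i.castSucc).face j :=
  StrictSeq.ext (congrArg MultiSeq.seq (x.toMultiSeq.face_face h))

variable {R : Type v} [CommRing R] (F : P ⥤ ModuleCat.{w} R)

/-- `S_k(P, F) = ⨁ F(x₁)`, the sum over the multi-sequences `x₁ ≤ ⋯ ≤ x_k` in `P ∖ 1`; for `k = 0`
there is one summand, `F(1)`. -/
abbrev SMod (k : ℕ) : Type (max u w) := ⨁ x : MultiSeq P k, F.obj x.head

/-- `C_k(P, F) = ⨁ F(x₁)`, the sum over the sequences `x₁ < ⋯ < x_k` in `P ∖ 1`; for `k = 0`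
there is one summand, `F(1)`. -/
abbrev CMod (k : ℕ) : Type (max u w) := ⨁ x : StrictSeq P k, F.obj x.toMultiSeq.head

open scoped Classical in
/-- The differential
`d(λ x₁⋯x_k) = F_{x₁}^{x₂}(λ) x₂⋯x_k + ∑_{i=2}^k (-1)^{i-1} λ x₁⋯x̂_i⋯x_k`, and `d(λ x) = F_x^1(λ)`.
Indices are shifted by one; when a term other than the first is deleted, the head does not change
and the map between colours below is the identity. -/
noncomputable def SMod.d (k : ℕ) : SMod F (k + 1) →ₗ[R] SMod F k :=
  DirectSum.toModule R (MultiSeq P (k + 1)) _ fun x =>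
    ∑ i : Fin (k + 1), (-1 : ℤ) ^ (i : ℕ) •
      (DirectSum.lof R (MultiSeq P k) (fun y => F.obj y.head) (x.face i) ∘ₗ
        (F.map (homOfLE (x.head_le_head_face i))).hom)

open scoped Classical in
/-- The same differential on sequences without repetitions. -/
noncomputable def CMod.d (k : ℕ) : CMod F (k + 1) →ₗ[R] CMod F k :=
  DirectSum.toModule R (StrictSeq P (k + 1)) _ fun x =>
    ∑ i : Fin (k + 1), (-1 : ℤ) ^ (i : ℕ) •
      (DirectSum.lof R (StrictSeq P k) (fun y => F.obj y.toMultiSeq.head) (x.face i) ∘ₗ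
        (F.map (homOfLE (x.head_le_head_face i))).hom)

open scoped Classical in
lemma SMod.d_lof (k : ℕ) (x : MultiSeq P (k + 1)) (a : F.obj x.head) :
    SMod.d F k (DirectSum.lof R (MultiSeq P (k + 1)) (fun y => F.obj y.head) x a) =
      ∑ i : Fin (k + 1), (-1 : ℤ) ^ (i : ℕ) •
        DirectSum.lof R (MultiSeq P k) (fun y => F.obj y.head) (x.face i)
          ((F.map (homOfLE (x.head_le_head_face i))).hom a) := by
  simp only [SMod.d, DirectSum.toModule_lof, LinearMap.sum_apply, LinearMap.smul_apply,
    LinearMap.comp_apply]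

open scoped Classical in
lemma SMod.d_comp_d (k : ℕ) : SMod.d F k ∘ₗ SMod.d F (k + 1) = 0 := by
  refine DirectSum.linearMap_ext R fun x => LinearMap.ext fun a => ?_
  have key : ∀ y z : MultiSeq P k, y = z → ∀ (hy : x.head ≤ y.head) (hz : x.head ≤ z.head),
      DirectSum.lof R (MultiSeq P k) (fun y => F.obj y.head) y ((F.map (homOfLE hy)).hom a) =
      DirectSum.lof R (MultiSeq P k) (fun y => F.obj y.head) z ((F.map (homOfLE hz)).hom a) := by
    rintro y _ rfl _ _
    rfl
  have h := alternating_sum_eq_zero (fun (i : Fin (k + 2)) (j : Fin (k + 1)) =>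
    DirectSum.lof R (MultiSeq P k) (fun y => F.obj y.head) ((x.face i).face j)
      ((F.map (homOfLE ((x.head_le_head_face i).trans
        ((x.face i).head_le_head_face j)))).hom a))
    fun i j hij => key _ _ (x.face_face hij) _ _
  rw [Fintype.sum_prod_type] at h
  rw [LinearMap.comp_apply, LinearMap.comp_apply, SMod.d_lof, map_sum, LinearMap.zero_comp,
    LinearMap.zero_apply, ← h]
  refine Finset.sum_congr rfl fun i _ => ?_
  rw [map_zsmul, SMod.d_lof, Finset.smul_sum]
  refine Finset.sum_congr rfl fun j _ => ?_
  rw [smul_smul, ← homOfLE_comp (x.head_le_head_face i) ((x.face i).head_le_head_face j),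
    F.map_comp]
  rfl

open scoped Classical in
lemma CMod.d_lof (k : ℕ) (x : StrictSeq P (k + 1)) (a : F.obj x.toMultiSeq.head) :
    CMod.d F k (DirectSum.lof R (StrictSeq P (k + 1)) (fun y => F.obj y.toMultiSeq.head) x a) =
      ∑ i : Fin (k + 1), (-1 : ℤ) ^ (i : ℕ) •
        DirectSum.lof R (StrictSeq P k) (fun y => F.obj y.toMultiSeq.head) (x.face i)
          ((F.map (homOfLE (x.head_le_head_face i))).hom a) := by
  simp only [CMod.d, DirectSum.toModule_lof, LinearMap.sum_apply, LinearMap.smul_apply,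
    LinearMap.comp_apply]

open scoped Classical in
lemma CMod.d_comp_d (k : ℕ) : CMod.d F k ∘ₗ CMod.d F (k + 1) = 0 := by
  refine DirectSum.linearMap_ext R fun x => LinearMap.ext fun a => ?_
  have key : ∀ y z : StrictSeq P k, y = z → ∀ (hy : x.toMultiSeq.head ≤ y.toMultiSeq.head) (hz : x.toMultiSeq.head ≤ z.toMultiSeq.head),
      DirectSum.lof R (StrictSeq P k) (fun y => F.obj y.toMultiSeq.head) y ((F.map (homOfLE hy)).hom a) =
      DirectSum.lof R (StrictSeq P k) (fun y => F.obj y.toMultiSeq.head) z ((F.map (homOfLE hz)).hom a) := by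
    rintro y _ rfl _ _
    rfl
  have h := alternating_sum_eq_zero (fun (i : Fin (k + 2)) (j : Fin (k + 1)) =>
    DirectSum.lof R (StrictSeq P k) (fun y => F.obj y.toMultiSeq.head) ((x.face i).face j)
      ((F.map (homOfLE ((x.head_le_head_face i).trans
        ((x.face i).head_le_head_face j)))).hom a))
    fun i j hij => key _ _ (x.face_face hij) _ _
  rw [Fintype.sum_prod_type] at h
  rw [LinearMap.comp_apply, LinearMap.comp_apply, CMod.d_lof, map_sum, LinearMap.zero_comp,
    LinearMap.zero_apply, ← h]
  refine Finset.sum_congr rfl fun i _ => ?_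
  rw [map_zsmul, CMod.d_lof, Finset.smul_sum]
  refine Finset.sum_congr rfl fun j _ => ?_
  rw [smul_smul, ← homOfLE_comp (x.head_le_head_face i) ((x.face i).head_le_head_face j),
    F.map_comp]
  rfl

/-- The complex `S_*(P, F)`; its homology is the homology `H_*(P, F)` of the coloured poset. -/
noncomputable def SComplex : ChainComplex (ModuleCat.{max u w} R) ℕ :=
  ChainComplex.of (fun k => ModuleCat.of R (SMod F k)) (fun k => ModuleCat.ofHom (SMod.d F k))
    fun k => by rw [← ModuleCat.ofHom_comp, SMod.d_comp_d]; rfl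

/-- The reduced complex `C_*(P, F)`. -/
noncomputable def CComplex : ChainComplex (ModuleCat.{max u w} R) ℕ :=
  ChainComplex.of (fun k => ModuleCat.of R (CMod F k)) (fun k => ModuleCat.ofHom (CMod.d F k))
    fun k => by rw [← ModuleCat.ofHom_comp, CMod.d_comp_d]; rfl

open scoped Classical in
/-- The inclusion of `C_k(P, F)` in `S_k(P, F)` as the summands indexed by the sequences without
repetitions. -/
noncomputable def CMod.incl (k : ℕ) : CMod F k →ₗ[R] SMod F k :=
  DirectSum.toModule R (StrictSeq P k) _ fun x =>
    DirectSum.lof R (MultiSeq P k) (fun y => F.obj y.head) x.toMultiSeq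

open scoped Classical in
lemma CMod.incl_lof (k : ℕ) (x : StrictSeq P k) (a : F.obj x.toMultiSeq.head) :
    CMod.incl F k (DirectSum.lof R (StrictSeq P k) (fun y => F.obj y.toMultiSeq.head) x a) =
      DirectSum.lof R (MultiSeq P k) (fun y => F.obj y.head) x.toMultiSeq a := by
  rw [CMod.incl, DirectSum.toModule_lof]

open scoped Classical in
lemma CMod.incl_comp_d (k : ℕ) :
    SMod.d F k ∘ₗ CMod.incl F (k + 1) = CMod.incl F k ∘ₗ CMod.d F k := by
  refine DirectSum.linearMap_ext R fun x => LinearMap.ext fun a => ?_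
  rw [LinearMap.comp_apply, LinearMap.comp_apply, LinearMap.comp_apply, LinearMap.comp_apply,
    CMod.incl_lof, SMod.d_lof, CMod.d_lof, map_sum]
  refine Finset.sum_congr rfl fun i _ => ?_
  rw [map_zsmul, CMod.incl_lof]
  rfl

/-- The inclusion of complexes `C_*(P, F) ⊆ S_*(P, F)`. -/
noncomputable def incl : CComplex F ⟶ SComplex F :=
  ChainComplex.ofHom (fun k => ModuleCat.ofHom (CMod.incl F k)) fun k => by
    simp only [CComplex, SComplex, ChainComplex.of_d]
    rw [← ModuleCat.ofHom_comp, ← ModuleCat.ofHom_comp, CMod.incl_comp_d]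

/-- The homology `H_n(P, F)` of a coloured poset. -/
noncomputable abbrev posetHomology (n : ℕ) : ModuleCat.{max u w} R := (SComplex F).homology n

end Complexes

/-! ### The cube complex of a coloured Boolean lattice

A Boolean lattice of rank `r` with ordered atoms `a_1, …, a_r` is a poset `B` with an isomorphism
`e` onto the lattice of subsets of `Fin r`; the atom with index `i` is the element that `e` sends
to `{i}`, and `e x` is the set of indices of the atoms whose join is `x`. -/

section Cube

/-- For subsets `s ⊂ t = s ∪ {ℓ}` (with `ℓ ∉ s`) this is the number of elements of `t` before `ℓ`:
the outer sum has the single term `ℓ`. -/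
def signExponent {r : ℕ} (s t : Finset (Fin r)) : ℕ :=
  ∑ l ∈ t \ s, (t.filter (· < l)).card

lemma signExponent_insert {r : ℕ} {s : Finset (Fin r)} {l : Fin r} (hl : l ∉ s) :
    signExponent s (insert l s) = (s.filter (· < l)).card := by
  have : insert l s \ s = {l} := by
    ext i; simp only [Finset.mem_sdiff, Finset.mem_insert, Finset.mem_singleton]
    constructor
    · tauto
    · rintro rfl; exact ⟨Or.inl rfl, hl⟩
  simp [signExponent, this, Finset.filter_insert]

lemma signExponent_square {r : ℕ} {s : Finset (Fin r)} {l m : Fin r} (hl : l ∉ s) (hm : m ∉ s)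
    (hlm : l ≠ m) :
    (-1 : ℤ) ^ (signExponent s (insert l s)) *
        (-1) ^ (signExponent (insert l s) (insert m (insert l s))) +
      (-1 : ℤ) ^ (signExponent s (insert m s)) *
        (-1) ^ (signExponent (insert m s) (insert l (insert m s))) = 0 := by
  rw [signExponent_insert hl, signExponent_insert hm, signExponent_insert (by simp [hlm.symm, hm]),
    signExponent_insert (by simp [hlm, hl])]
  rcases lt_or_gt_of_ne hlm with h | h
  · rw [Finset.filter_insert, Finset.filter_insert, if_pos h, if_neg (not_lt.2 h.le),
      Finset.card_insert_of_notMem (by simp [hl])]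
    ring
  · rw [Finset.filter_insert, Finset.filter_insert, if_pos h, if_neg (not_lt.2 h.le),
      Finset.card_insert_of_notMem (by simp [hm])]
    ring

variable {B : Type u} [PartialOrder B] {r : ℕ} (e : B ≃o Finset (Fin r))

/-- The rank of an element of the Boolean lattice: the number of atoms below it. -/
def rk (x : B) : ℕ := (e x).card

/-- The sign `ε(x <_c y) = (-1)^j` of a covering relation, `j` being the number of atoms that come
before the new atom in the expression of `y` as a join of atoms. -/
def sgn (x y : B) : ℤ := (-1) ^ signExponent (e x) (e y)

variable {R : Type v} [CommRing R] (F : B ⥤ ModuleCat.{w} R)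

/-- `K_k(B, F) = ⨁ F(x)`, the sum over the `x` of rank `r - k`. -/
abbrev KMod (k : ℕ) : Type (max u w) := ⨁ x : {x : B // rk e x + k = r}, F.obj x.1

lemma finite_of_iso {B : Type u} [PartialOrder B] {r : ℕ} (e : B ≃o Finset (Fin r)) : Finite B :=
  Finite.of_equiv _ e.symm.toEquiv

open scoped Classical in
/-- The differential `d(λ) = ∑ ε(x <_c y) F_x^y(λ)` for `λ ∈ F(x)`, the sum over all `y` that
cover `x`. -/
noncomputable def KMod.d (k : ℕ) : KMod e F (k + 1) →ₗ[R] KMod e F k :=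
  haveI := finite_of_iso e
  letI : Fintype {y : B // rk e y + k = r} := Fintype.ofFinite _
  DirectSum.toModule R {x : B // rk e x + (k + 1) = r} _ fun x =>
    ∑ y : {y : B // rk e y + k = r},
      if h : x.1 ⋖ y.1 then
        sgn e x.1 y.1 •
          (DirectSum.lof R {y : B // rk e y + k = r} (fun y => F.obj y.1) y ∘ₗ
            (F.map (homOfLE h.le)).hom)
      else 0

open scoped Classical in
/-- All squares anticommute. -/
lemma sum_sgn_mul_sgn [Fintype B] (x y : B) :
    ∑ z : B, (if x ⋖ z ∧ z ⋖ y then sgn e x z * sgn e z y else 0) = 0 := by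
  have hcov : ∀ a b : B, a ⋖ b ↔ ∃ l ∉ e a, insert l (e a) = e b := fun a b => by
    rw [← Finset.covBy_iff_exists_insert, apply_covBy_apply_iff]
  rw [← Finset.sum_filter]
  let g : B → B := fun z => e.symm (e x ∪ (e y \ e z))
  have hg : ∀ z, x ⋖ z ∧ z ⋖ y → ∃ l m, l ∉ e x ∧ m ∉ e x ∧ l ≠ m ∧ e z = insert l (e x) ∧
      e y = insert m (insert l (e x)) ∧ e (g z) = insert m (e x) := by
    rintro z ⟨h1, h2⟩
    obtain ⟨l, hl, h1⟩ := (hcov _ _).1 h1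
    obtain ⟨m, hm, h2⟩ := (hcov _ _).1 h2
    rw [← h1] at hm h2
    simp only [Finset.mem_insert, not_or] at hm
    refine ⟨l, m, hl, hm.2, Ne.symm hm.1, h1.symm, h2.symm, ?_⟩
    simp only [g, OrderIso.apply_symm_apply, ← h1, ← h2]
    ext i
    simp only [Finset.mem_union, Finset.mem_sdiff, Finset.mem_insert]
    constructor
    · tauto
    · rintro (rfl | h)
      · exact Or.inr ⟨Or.inl rfl, by tauto⟩
      · exact Or.inl h
  refine Finset.sum_involution (fun z _ => g z) ?_ ?_ ?_ ?_
  · intro z hz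
    obtain ⟨l, m, hl, hm, hlm, h1, h2, h3⟩ := hg z (Finset.mem_filter.1 hz).2
    simp only [sgn, h1, h3, h2]
    rw [Finset.insert_comm m l]
    have := signExponent_square hl hm hlm
    rwa [Finset.insert_comm m l] at this
  · intro z hz _ h
    obtain ⟨l, m, hl, hm, hlm, h1, h2, h3⟩ := hg z (Finset.mem_filter.1 hz).2
    rw [h, h1] at h3
    have : l ∈ insert m (e x) := h3 ▸ Finset.mem_insert_self _ _
    simp [hlm, hl] at this
  · intro z hz
    obtain ⟨l, m, hl, hm, hlm, h1, h2, h3⟩ := hg z (Finset.mem_filter.1 hz).2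
    refine Finset.mem_filter.2 ⟨Finset.mem_univ _, (hcov _ _).2 ⟨m, hm, h3.symm⟩,
      (hcov _ _).2 ⟨l, ?_, ?_⟩⟩
    · rw [h3]; simp [hlm, hl]
    · rw [h3, h2, Finset.insert_comm]
  · intro z hz
    obtain ⟨l, m, hl, hm, hlm, h1, h2, h3⟩ := hg z (Finset.mem_filter.1 hz).2
    apply e.injective
    simp only [g, OrderIso.apply_symm_apply] at h3 ⊢
    rw [h3, h1, h2]
    ext i
    simp only [Finset.mem_union, Finset.mem_sdiff, Finset.mem_insert]
    constructor
    · tauto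
    · rintro (rfl | h)
      · exact Or.inr ⟨Or.inr (Or.inl rfl), by tauto⟩
      · exact Or.inl h

lemma rk_of_covBy {x z : B} (h : x ⋖ z) : rk e z = rk e x + 1 := by
  rw [← apply_covBy_apply_iff e, Finset.covBy_iff_exists_insert] at h
  obtain ⟨l, hl, h⟩ := h
  rw [rk, ← h, Finset.card_insert_of_notMem hl, rk]

open scoped Classical in
lemma KMod.d_lof (k : ℕ) [Fintype {y : B // rk e y + k = r}] (x : {x : B // rk e x + (k + 1) = r})
    (a : F.obj x.1) :
    KMod.d e F k (DirectSum.lof R {x : B // rk e x + (k + 1) = r} (fun y => F.obj y.1) x a) =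
      ∑ y : {y : B // rk e y + k = r},
        if h : x.1 ⋖ y.1 then
          sgn e x.1 y.1 • DirectSum.lof R {y : B // rk e y + k = r} (fun y => F.obj y.1) y
            ((F.map (homOfLE h.le)).hom a)
        else 0 := by
  rw [KMod.d, DirectSum.toModule_lof, LinearMap.sum_apply]
  refine Finset.sum_congr (by ext; simp) fun y _ => ?_
  split_ifs <;> rfl

open scoped Classical in
lemma KMod.d_comp_d (k : ℕ) : KMod.d e F k ∘ₗ KMod.d e F (k + 1) = 0 := by
  have := finite_of_iso e
  let : Fintype B := Fintype.ofFinite _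
  refine DirectSum.linearMap_ext R fun x => LinearMap.ext fun a => ?_
  let f : {y : B // rk e y + k = r} → KMod e F k := fun y =>
    if h : x.1 ≤ y.1 then
      DirectSum.lof R {y : B // rk e y + k = r} (fun y => F.obj y.1) y
        ((F.map (homOfLE h)).hom a)
    else 0
  have h1 : ∀ z : {z : B // rk e z + (k + 1) = r},
      KMod.d e F k (if h : x.1 ⋖ z.1 then
          sgn e x.1 z.1 • DirectSum.lof R {y : B // rk e y + (k + 1) = r} (fun y => F.obj y.1) z
            ((F.map (homOfLE h.le)).hom a)
        else 0) = ∑ y : {y : B // rk e y + k = r},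
        (if x.1 ⋖ z.1 ∧ z.1 ⋖ y.1 then sgn e x.1 z.1 * sgn e z.1 y.1 else 0) • f y := by
    intro z
    by_cases hz : x.1 ⋖ z.1
    · rw [dif_pos hz, map_zsmul, KMod.d_lof, Finset.smul_sum]
      refine Finset.sum_congr rfl fun y _ => ?_
      by_cases hy : z.1 ⋖ y.1
      · have hxy : x.1 ≤ y.1 := hz.le.trans hy.le
        rw [dif_pos hy, smul_smul, if_pos ⟨hz, hy⟩]
        simp only [f]
        rw [dif_pos hxy, ← homOfLE_comp hz.le hy.le, F.map_comp]
        rfl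
      · simp [hy]
    · simp [hz]
  rw [LinearMap.comp_apply, LinearMap.comp_apply, KMod.d_lof, map_sum, LinearMap.zero_comp,
    LinearMap.zero_apply, Finset.sum_congr rfl fun z _ => h1 z, Finset.sum_comm]
  refine Finset.sum_eq_zero fun y _ => ?_
  rw [← Finset.sum_smul]
  have h2 : ∑ z : {z : B // rk e z + (k + 1) = r},
      (if x.1 ⋖ z.1 ∧ z.1 ⋖ y.1 then sgn e x.1 z.1 * sgn e z.1 y.1 else 0) = 0 := by
    refine Eq.trans ?_ (sum_sgn_mul_sgn e x.1 y.1)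
    refine Finset.sum_of_injOn Subtype.val Subtype.val_injective.injOn (by simp) ?_ fun _ _ => rfl
    intro z _ hz
    refine if_neg fun h => hz ?_
    have h3 := rk_of_covBy e h.1
    have h4 := x.2
    exact ⟨⟨z, by omega⟩, by simp, rfl⟩
  rw [h2, zero_smul]

/-- Khovanov's cube complex `K_*(B, F)`. -/
noncomputable def KComplex : ChainComplex (ModuleCat.{max u w} R) ℕ :=
  ChainComplex.of (fun k => ModuleCat.of R (KMod e F k)) (fun k => ModuleCat.ofHom (KMod.d e F k))
    fun k => by rw [← ModuleCat.ofHom_comp, KMod.d_comp_d]; rfl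

/-- The homology `H^⋄_n(B, F)` of the cube complex. -/
noncomputable abbrev cubeHomology (n : ℕ) : ModuleCat.{max u w} R := (KComplex e F).homology n

/-! ### The map `φ` -/

variable [OrderTop B]

/-- Saturated sequences `x = x₁ <_c x₂ <_c ⋯ <_c x_{n+1} = 1`. In a Boolean lattice of rank `r`
every saturated sequence from an element `x` of rank `r - n` to `1` has this length. -/
def SatSeq (x : B) (n : ℕ) : Type u :=
  {c : Fin (n + 1) → B // c 0 = x ∧ c (Fin.last n) = ⊤ ∧ ∀ i : Fin n, c i.castSucc ⋖ c i.succ}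

/-- The sign of a saturated sequence, the product of the signs of its covering relations. -/
def SatSeq.sgn {x : B} {n : ℕ} (c : SatSeq x n) : ℤ :=
  ∏ i : Fin n, ColouredPoset.sgn e (c.1 i.castSucc) (c.1 i.succ)

lemma SatSeq.strictMono {x : B} {n : ℕ} (c : SatSeq x n) : StrictMono c.1 :=
  Fin.strictMono_iff_lt_succ.2 fun i => (c.2.2.2 i).lt

/-- The sequence `x₁ <_c ⋯ <_c x_n` obtained from `x₁ <_c ⋯ <_c x_n <_c x_{n+1} = 1` by deleting
the last term. -/
def SatSeq.trunc {x : B} {n : ℕ} (c : SatSeq x n) : StrictSeq B n where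
  seq i := c.1 i.castSucc
  monotone _ _ h := c.strictMono.monotone (Fin.castSucc_le_castSucc_iff.2 h)
  ne_top i := ((c.strictMono (Fin.castSucc_lt_last i)).trans_eq c.2.2.1).ne
  strictMono _ _ h := c.strictMono (Fin.castSucc_lt_castSucc_iff.2 h)

lemma SatSeq.head_trunc {x : B} {n : ℕ} (c : SatSeq x n) : x = c.trunc.toMultiSeq.head := by
  cases n with
  | zero => exact c.2.1.symm.trans c.2.2.1
  | succ n => exact c.2.1.symm

instance SatSeq.finite [Finite B] (x : B) (n : ℕ) : Finite (SatSeq x n) :=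
  inferInstanceAs (Finite {_c : Fin (n + 1) → B // _})

open scoped Classical in
/-- The map `φ : K_n(B, F) → C_n(B, F)` that sends `λ ∈ F(x)` to the sum, over all saturated
sequences `𝐱` from `x` to `1`, of the sign of `𝐱` times `λ` in the summand of the sequence
`𝐱` without its last term. That summand is `F(x)`, via the identity `F(x) = F(x₁)`. -/
noncomputable def phi (n : ℕ) : KMod e F n →ₗ[R] CMod F n :=
  haveI := finite_of_iso e
  DirectSum.toModule R {x : B // rk e x + n = r} _ fun x =>
    letI : Fintype (SatSeq x.1 n) := Fintype.ofFinite _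
    ∑ c : SatSeq x.1 n, c.sgn e •
      (DirectSum.lof R (StrictSeq B n) (fun y => F.obj y.toMultiSeq.head) c.trunc ∘ₗ
        (F.map (eqToHom c.head_trunc)).hom)

end Cube

end ColouredPoset

/-! In each degree the complexes `K`, `C` and `S` are direct sums of colours, so they are exact
functors of the colouring, and both `φ` and the inclusion `C ⊆ S` are natural in it. This reduces
both quasi-isomorphism claims to principal colourings, those equal to a module `M` on the elements
above some `z` and zero elsewhere (`quasiIso_app_of_principal`). The reduction is an induction on an
upper set `U` that supports `F`. For `z` minimal in `U`, the canonical map to `F` from the principal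
colouring of `F(z)` at `z` is an isomorphism at `z`, so its kernel and cokernel are supported on `U`
without `z`. Two short exact sequences and the five lemma then carry the claim from kernel,
principal colouring and cokernel to `F`.

For principal colourings there are two cases. If `z = 1`, the complexes live in degree 0 and the
chain maps are isomorphisms. If `z ≠ 1`, all three complexes are contractible, so every chain map
between them is a quasi-isomorphism. In `C` and `S` the contraction puts `z` in front of a sequence
(`CMod.d_contract_succ`, `SMod.d_contract_succ`); in `K` it removes a fixed atom that is not below
`z` (`KMod.d_contract_succ`).

The formula for `φ` matters mainly for the chain map property (`phi_comp_d`). Deleting a term other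
than the first from a saturated sequence leaves a gap of rank two that can be filled in exactly two
ways, with opposite signs, so these faces cancel. Deleting the first term leaves a saturated
sequence that starts at a cover of `x`, and these faces add up to `φ(dλ)`. -/

open CategoryTheory Limits

/-! ### Five lemma for the middle term of short exact sequences of complexes -/

namespace HomologicalComplex.HomologySequence

variable {C ι : Type*} [Category C] [Abelian C] {c : ComplexShape ι}
  {S₁ S₂ : ShortComplex (HomologicalComplex C c)} (φ : S₁ ⟶ S₂)

open ComposableArrows Abelian

/-- A morphism of short exact sequences of complexes is a quasi-isomorphism in the middle if it is
one at both ends. -/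
lemma quasiIso_τ₂ (hS₁ : S₁.ShortExact) (hS₂ : S₂.ShortExact) (h₁ : QuasiIso φ.τ₁)
    (h₃ : QuasiIso φ.τ₃) : QuasiIso φ.τ₂ := by
  have i₁ : ∀ i, IsIso (homologyMap φ.τ₁ i) := fun i => inferInstance
  have i₃ : ∀ i, IsIso (homologyMap φ.τ₃ i) := fun i => inferInstance
  rw [quasiIso_iff]
  intro i
  rw [quasiIsoAt_iff_isIso_homologyMap]
  have : Mono (homologyMap φ.τ₂ i) := by
    by_cases hi : ∃ j, c.Rel j i
    · obtain ⟨j, hij⟩ := hi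
      -- Four lemma on `H_j(X₃) → H_i(X₁) → H_i(X₂) → H_i(X₃)`, the last four terms of the six-term
      -- sequence.
      apply mono_of_epi_of_mono_of_mono
        ((δ₀Functor ⋙ δ₀Functor).map (mapComposableArrows₅ φ hS₁ hS₂ j i hij))
      · exact (composableArrows₅_exact hS₁ j i hij).δ₀.δ₀
      · exact (composableArrows₅_exact hS₂ j i hij).δ₀.δ₀
      · have := i₃ j
        exact inferInstanceAs (Epi (homologyMap φ.τ₃ j))
      · have := i₁ i
        exact inferInstanceAs (Mono (homologyMap φ.τ₁ i))
      · have := i₃ i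
        exact inferInstanceAs (Mono (homologyMap φ.τ₃ i))
    -- No differential enters degree `i`, so there is no connecting map into `H_i(X₁)`; instead `f`
    -- is already mono on homology.
    · have := hS₂.mono_f
      have h := mono_homologyMap_of_mono_of_not_rel S₂.f i (by simpa using hi)
      exact mono_of_mono_of_mono_of_mono (mapComposableArrows₂ φ i)
        (composableArrows₂_exact hS₁ i) h (@IsIso.mono_of_iso _ _ _ _ _ (i₁ i))
        (@IsIso.mono_of_iso _ _ _ _ _ (i₃ i))
  have : Epi (homologyMap φ.τ₂ i) := by
    by_cases hi : ∃ j, c.Rel i j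
    · obtain ⟨j, hij⟩ := hi
      -- Dually, the first four terms `H_i(X₁) → H_i(X₂) → H_i(X₃) → H_j(X₁)`.
      apply epi_of_epi_of_epi_of_mono
        ((δlastFunctor ⋙ δlastFunctor).map (mapComposableArrows₅ φ hS₁ hS₂ i j hij))
      · exact (composableArrows₅_exact hS₁ i j hij).δlast.δlast
      · exact (composableArrows₅_exact hS₂ i j hij).δlast.δlast
      · have := i₁ i
        exact inferInstanceAs (Epi (homologyMap φ.τ₁ i))
      · have := i₃ i
        exact inferInstanceAs (Epi (homologyMap φ.τ₃ i))
      · have := i₁ j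
        exact inferInstanceAs (Mono (homologyMap φ.τ₁ j))
    · have := hS₁.epi_g
      have h := epi_homologyMap_of_epi_of_not_rel S₁.g i (by simpa using hi)
      exact epi_of_epi_of_epi_of_epi (mapComposableArrows₂ φ i)
        (composableArrows₂_exact hS₂ i) h (@IsIso.epi_of_iso _ _ _ _ _ (i₁ i))
        (@IsIso.epi_of_iso _ _ _ _ _ (i₃ i))
  exact isIso_of_mono_of_epi _

end HomologicalComplex.HomologySequence

/-! ### Acyclicity from a contraction -/

/-- A chain complex of modules with a contraction is acyclic. -/
lemma ChainComplex.of_acyclic_of_contraction {R : Type*} [Ring R] (X : ℕ → ModuleCat R)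
    (d : ∀ n, X (n + 1) ⟶ X n) (hd : ∀ n, d (n + 1) ≫ d n = 0) (s : ∀ n, X n → X (n + 1))
    (h0 : ∀ x, (d 0).hom (s 0 x) = x)
    (hs : ∀ n x, (d (n + 1)).hom (s (n + 1) x) + s n ((d n).hom x) = x) (hs0 : ∀ n, s n 0 = 0) :
    (ChainComplex.of X d hd).Acyclic := by
  intro n
  cases n with
  | zero =>
    rw [HomologicalComplex.exactAt_iff' _ 1 0 0 (by simp) (by simp),
      ShortComplex.moduleCat_exact_iff]
    intro x _
    refine ⟨s 0 x, ?_⟩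
    have : (ChainComplex.of X d hd).d 1 0 = d 0 := ChainComplex.of_d X d 0
    change ((ChainComplex.of X d hd).d 1 0).hom (s 0 x) = x
    rw [this]
    exact h0 x
  | succ n =>
    rw [HomologicalComplex.exactAt_iff' _ (n + 2) (n + 1) n (by simp) (by simp),
      ShortComplex.moduleCat_exact_iff]
    intro x hx
    refine ⟨s (n + 1) x, ?_⟩
    have h1 : (ChainComplex.of X d hd).d (n + 2) (n + 1) = d (n + 1) :=
      ChainComplex.of_d X d (n + 1)
    have h2 : (ChainComplex.of X d hd).d (n + 1) n = d n := ChainComplex.of_d X d n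
    change ((ChainComplex.of X d hd).d (n + 2) (n + 1)).hom (s (n + 1) x) = x
    change ((ChainComplex.of X d hd).d (n + 1) n).hom x = 0 at hx
    rw [h2] at hx
    rw [h1]
    -- For a cycle the homotopy formula reads `d (s x) + s 0 = x`; additivity of `s` is not needed,
    -- only `s 0 = 0`.
    simpa [hx, hs0] using hs n x

namespace ColouredPoset

/-! ### The three complexes as exact functors of the colouring -/

section Functoriality

variable {R : Type v} [CommRing R] {P : Type u} [PartialOrder P]

/-- The functor `F ↦ ⨁ i, F (a i)` on colourings, for a family `a` of elements of the poset. -/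
noncomputable def dsum {I : Type u} (a : I → P) :
    (P ⥤ ModuleCat.{w} R) ⥤ ModuleCat.{max u w} R where
  obj F := ModuleCat.of R (⨁ i, F.obj (a i))
  map α := ModuleCat.ofHom (DirectSum.lmap fun i => (α.app (a i)).hom)
  map_id F := by
    ext : 1
    exact DirectSum.lmap_id
  map_comp α β := by
    ext : 1
    exact DirectSum.lmap_comp _ _

instance {I : Type u} (a : I → P) : (dsum (R := R) a).PreservesZeroMorphisms where
  map_zero F G := by
    ext x : 2
    exact DFinsupp.ext fun i => rfl

/-- Direct sums of colours are exact in the colouring. -/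
lemma dsum_map_shortExact {I : Type u} (a : I → P) {S : ShortComplex (P ⥤ ModuleCat.{w} R)}
    (hS : S.ShortExact) : (S.map (dsum a)).ShortExact := by
  -- Evaluation at an element is exact, so exactness can be checked one colour at a time.
  have h : ∀ i, (S.map ((evaluation _ _).obj (a i))).ShortExact := fun i =>
    hS.map_of_exact ((evaluation _ _).obj (a i))
  have hinj : ∀ i, Function.Injective (S.f.app (a i)).hom := fun i =>
    (h i).moduleCat_injective_f
  have hsurj : ∀ i, Function.Surjective (S.g.app (a i)).hom := fun i =>
    (h i).moduleCat_surjective_g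
  have hex : ∀ i, Function.Exact (S.f.app (a i)).hom (S.g.app (a i)).hom := fun i =>
    (ShortComplex.ShortExact.moduleCat_exact_iff_function_exact _).1 (h i).exact
  refine { exact := ?_, mono_f := ?_, epi_g := ?_ }
  · rw [ShortComplex.moduleCat_exact_iff]
    intro x hx
    change DirectSum.lmap (fun i => (S.g.app (a i)).hom) x = 0 at hx
    change ⨁ i, S.X₂.obj (a i) at x
    change ∃ y, DirectSum.lmap (fun i => (S.f.app (a i)).hom) y = x
    have hx' : ∀ i, (S.g.app (a i)).hom (x i) = 0 := fun i => by
      rw [← DirectSum.lmap_apply (fun i => (S.g.app (a i)).hom), hx]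
      rfl
    have : x ∈ LinearMap.range (DirectSum.lmap (fun i => (S.f.app (a i)).hom)) := by
      rw [DirectSum.range_lmap]
      exact fun i _ => (hex i _).1 (hx' i)
    exact this
  · rw [ModuleCat.mono_iff_injective]
    exact (DirectSum.lmap_injective _).2 hinj
  · rw [ModuleCat.epi_iff_surjective]
    exact (DirectSum.lmap_surjective _).2 hsurj

open scoped Classical in
/-- `F ↦ K_*(P, F)` as a functor. -/
noncomputable def KFunctor {r : ℕ} (e : P ≃o Finset (Fin r)) :
    (P ⥤ ModuleCat.{w} R) ⥤ ChainComplex (ModuleCat.{max u w} R) ℕ where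
  obj F := KComplex e F
  map {F G} α := ChainComplex.ofHom (fun k =>
      (dsum fun x : {x : P // rk e x + k = r} => x.1).map α) fun k => by
    simp only [KComplex, ChainComplex.of_d]
    ext : 1
    refine DirectSum.linearMap_ext R fun x => LinearMap.ext fun a => Eq.symm ?_
    have := finite_of_iso e
    let : Fintype {y : P // rk e y + k = r} := Fintype.ofFinite _
    change DirectSum.lmap (fun x : {x : P // rk e x + k = r} => (α.app x.1).hom)
        (KMod.d e F k (DirectSum.lof R _ _ x a)) =
      KMod.d e G k (DirectSum.lmap (fun x : {x : P // rk e x + (k + 1) = r} => (α.app x.1).hom)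
        (DirectSum.lof R _ _ x a))
    rw [KMod.d_lof, DirectSum.lmap_lof, KMod.d_lof, map_sum]
    refine Finset.sum_congr rfl fun y _ => ?_
    split_ifs with h
    · rw [map_zsmul, DirectSum.lmap_lof, ← NatTrans.naturality_apply]
    · rw [map_zero]
  map_id F := by ext n : 1; exact (dsum _).map_id F
  map_comp α β := by ext n : 1; exact (dsum _).map_comp α β

instance {r : ℕ} (e : P ≃o Finset (Fin r)) :
    (KFunctor e (R := R) (P := P)).PreservesZeroMorphisms where
  map_zero F G := by ext n : 1; exact (dsum fun x : {x : P // rk e x + n = r} => x.1).map_zero F G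

lemma KFunctor_map_shortExact {r : ℕ} (e : P ≃o Finset (Fin r)) {S : ShortComplex (P ⥤ ModuleCat.{w} R)}
    (hS : S.ShortExact) : (S.map (KFunctor e)).ShortExact :=
  HomologicalComplex.shortExact_of_degreewise_shortExact _ fun _ => dsum_map_shortExact _ hS

variable [OrderTop P]

open scoped Classical in
/-- `F ↦ C_*(P, F)` as a functor. -/
noncomputable def CFunctor :
    (P ⥤ ModuleCat.{w} R) ⥤ ChainComplex (ModuleCat.{max u w} R) ℕ where
  obj F := CComplex F
  map {F G} α := ChainComplex.ofHom (fun k =>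
      (dsum fun x : StrictSeq P k => x.toMultiSeq.head).map α) fun k => by
    simp only [CComplex, ChainComplex.of_d]
    ext : 1
    refine DirectSum.linearMap_ext R fun x => LinearMap.ext fun a => Eq.symm ?_
    change DirectSum.lmap (fun x : StrictSeq P k => (α.app x.toMultiSeq.head).hom)
        (CMod.d F k (DirectSum.lof R _ _ x a)) =
      CMod.d G k (DirectSum.lmap (fun x : StrictSeq P (k + 1) => (α.app x.toMultiSeq.head).hom)
        (DirectSum.lof R _ _ x a))
    rw [CMod.d_lof, DirectSum.lmap_lof, CMod.d_lof, map_sum]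
    refine Finset.sum_congr rfl fun i _ => ?_
    rw [map_zsmul, DirectSum.lmap_lof, ← NatTrans.naturality_apply]
  map_id F := by ext n : 1; exact (dsum _).map_id F
  map_comp α β := by ext n : 1; exact (dsum _).map_comp α β

instance : (CFunctor (R := R) (P := P)).PreservesZeroMorphisms where
  map_zero F G := by ext n : 1; exact (dsum fun x : StrictSeq P n => x.toMultiSeq.head).map_zero F G

lemma CFunctor_map_shortExact {S : ShortComplex (P ⥤ ModuleCat.{w} R)}
    (hS : S.ShortExact) : (S.map (CFunctor)).ShortExact :=
  HomologicalComplex.shortExact_of_degreewise_shortExact _ fun _ => dsum_map_shortExact _ hS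

open scoped Classical in
/-- `F ↦ S_*(P, F)` as a functor. -/
noncomputable def SFunctor :
    (P ⥤ ModuleCat.{w} R) ⥤ ChainComplex (ModuleCat.{max u w} R) ℕ where
  obj F := SComplex F
  map {F G} α := ChainComplex.ofHom (fun k => (dsum fun x : MultiSeq P k => x.head).map α) fun k => by
    simp only [SComplex, ChainComplex.of_d]
    ext : 1
    refine DirectSum.linearMap_ext R fun x => LinearMap.ext fun a => Eq.symm ?_
    change DirectSum.lmap (fun x : MultiSeq P k => (α.app x.head).hom)
        (SMod.d F k (DirectSum.lof R _ _ x a)) =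
      SMod.d G k (DirectSum.lmap (fun x : MultiSeq P (k + 1) => (α.app x.head).hom)
        (DirectSum.lof R _ _ x a))
    rw [SMod.d_lof, DirectSum.lmap_lof, SMod.d_lof, map_sum]
    refine Finset.sum_congr rfl fun i _ => ?_
    rw [map_zsmul, DirectSum.lmap_lof, ← NatTrans.naturality_apply]
  map_id F := by ext n : 1; exact (dsum _).map_id F
  map_comp α β := by ext n : 1; exact (dsum _).map_comp α β

instance : (SFunctor (R := R) (P := P)).PreservesZeroMorphisms where
  map_zero F G := by ext n : 1; exact (dsum fun x : MultiSeq P n => x.head).map_zero F G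

lemma SFunctor_map_shortExact {S : ShortComplex (P ⥤ ModuleCat.{w} R)}
    (hS : S.ShortExact) : (S.map (SFunctor)).ShortExact :=
  HomologicalComplex.shortExact_of_degreewise_shortExact _ fun _ => dsum_map_shortExact _ hS

end Functoriality

/-! ### Swapping an interior term of a saturated sequence -/

section ChainMap

variable {B : Type u} [PartialOrder B] {r : ℕ} (e : B ≃o Finset (Fin r))

/-- For `a ⋖ m ⋖ b` in a Boolean lattice this is the other element between `a` and `b`. -/
def swapMid (a m b : B) : B := e.symm (e a ∪ (e b \ e m))

/-- If `m` adds the atom `l` to `a` and `b` then adds `k`, the swapped element adds `k` to `a`, so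
the two new atoms are joined in the other order. The sign rule is the anticommutation of squares,
`signExponent_square`. -/
lemma swapMid_spec {a m b : B} (h₁ : a ⋖ m) (h₂ : m ⋖ b) :
    a ⋖ swapMid e a m b ∧ swapMid e a m b ⋖ b ∧ swapMid e a m b ≠ m ∧
      swapMid e a (swapMid e a m b) b = m ∧
      sgn e a (swapMid e a m b) * sgn e (swapMid e a m b) b = -(sgn e a m * sgn e m b) := by
  have hcov : ∀ a b : B, a ⋖ b ↔ ∃ l ∉ e a, insert l (e a) = e b := fun a b => by
    rw [← Finset.covBy_iff_exists_insert, apply_covBy_apply_iff]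
  obtain ⟨l, hl, hm⟩ := (hcov _ _).1 h₁
  obtain ⟨k, hk, hb⟩ := (hcov _ _).1 h₂
  rw [← hm] at hk hb
  simp only [Finset.mem_insert, not_or] at hk
  have hs : e (swapMid e a m b) = insert k (e a) := by
    simp only [swapMid, OrderIso.apply_symm_apply, ← hm, ← hb]
    grind
  refine ⟨(hcov _ _).2 ⟨k, hk.2, hs.symm⟩, (hcov _ _).2 ⟨l, ?_, ?_⟩, ?_, ?_, ?_⟩
  · rw [hs]; grind
  · rw [hs, ← hb, Finset.insert_comm]
  · intro h
    have : insert k (e a) = insert l (e a) := by rw [← hs, h, hm]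
    grind
  · apply e.injective
    rw [swapMid, OrderIso.apply_symm_apply, hs, ← hb, ← hm]
    grind
  · have := signExponent_square hl hk.2 (Ne.symm hk.1)
    simp only [sgn, hs, ← hm, ← hb]
    rw [Finset.insert_comm k l] at this ⊢
    linarith

/-- Swapping one interior term changes just two factors of the sign of a saturated sequence: the
coverings below and above that term. -/
lemma prod_eq_neg_prod {ι : Type*} [Fintype ι] [DecidableEq ι] {f g : ι → ℤ} {p q : ι}
    (hpq : p ≠ q) (h : f p * f q = -(g p * g q)) (hfg : ∀ i, i ≠ p → i ≠ q → f i = g i) :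
    ∏ i, f i = -∏ i, g i := by
  rw [← Finset.mul_prod_erase _ f (Finset.mem_univ p), ← Finset.mul_prod_erase _ g
    (Finset.mem_univ p), ← Finset.mul_prod_erase _ f (a := q) (by simp [hpq.symm]),
    ← Finset.mul_prod_erase _ g (a := q) (by simp [hpq.symm]), ← mul_assoc, ← mul_assoc, h,
    neg_mul]
  congr 2
  exact Finset.prod_congr rfl fun i hi => hfg i (by grind) (by grind)

variable [OrderTop B]

/-- Replace one interior term of a saturated sequence by the only other possible term. -/
def SatSeq.swap {x : B} {n : ℕ} (c : SatSeq x (n + 1)) (j : Fin n) : SatSeq x (n + 1) :=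
  -- The position is `j + 1`, which ranges over `1, …, n`: neither the first term nor the final `1`
  -- at position `n + 1` is ever replaced.
  ⟨Function.update c.1 j.succ.castSucc
    (swapMid e (c.1 j.castSucc.castSucc) (c.1 j.succ.castSucc) (c.1 j.succ.succ)), by
    have hs := swapMid_spec e (c.2.2.2 j.castSucc) (c.2.2.2 j.succ)
    rw [Fin.succ_castSucc] at hs
    refine ⟨?_, ?_, fun i => ?_⟩
    · rw [Function.update_of_ne (by simp [Fin.ext_iff]), c.2.1]
    · rw [Function.update_of_ne (Fin.castSucc_lt_last _).ne', c.2.2.1]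
    · by_cases h1 : i = j.castSucc
      · subst h1
        rw [Fin.succ_castSucc, Function.update_self,
          Function.update_of_ne (by simp [Fin.ext_iff])]
        exact hs.1
      · by_cases h2 : i = j.succ
        · subst h2
          rw [Function.update_self, Function.update_of_ne (by simp [Fin.ext_iff])]
          exact hs.2.1
        · rw [Function.update_of_ne, Function.update_of_ne]
          · exact c.2.2.2 i
          · rw [← Fin.succ_castSucc]; exact fun h => h1 (Fin.succ_injective _ h)
          · exact fun h => h2 (Fin.castSucc_injective _ h)⟩

lemma SatSeq.swap_apply_of_ne {x : B} {n : ℕ} (c : SatSeq x (n + 1)) (j : Fin n) {i : Fin (n + 2)}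
    (h : i ≠ j.succ.castSucc) : (c.swap e j).1 i = c.1 i :=
  Function.update_of_ne h _ _

lemma SatSeq.swap_apply_self {x : B} {n : ℕ} (c : SatSeq x (n + 1)) (j : Fin n) :
    (c.swap e j).1 j.succ.castSucc =
      swapMid e (c.1 j.castSucc.castSucc) (c.1 j.succ.castSucc) (c.1 j.succ.succ) :=
  Function.update_self ..

lemma SatSeq.swap_ne {x : B} {n : ℕ} (c : SatSeq x (n + 1)) (j : Fin n) : c.swap e j ≠ c := by
  intro h
  have h1 := c.swap_apply_self e j
  rw [h] at h1
  have hs := swapMid_spec e (c.2.2.2 j.castSucc) (c.2.2.2 j.succ)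
  rw [Fin.succ_castSucc] at hs
  exact hs.2.2.1 h1.symm

lemma SatSeq.swap_swap {x : B} {n : ℕ} (c : SatSeq x (n + 1)) (j : Fin n) :
    (c.swap e j).swap e j = c := by
  refine Subtype.ext (funext fun i => ?_)
  by_cases hi : i = j.succ.castSucc
  · subst hi
    have hs := swapMid_spec e (c.2.2.2 j.castSucc) (c.2.2.2 j.succ)
    rw [Fin.succ_castSucc] at hs
    rw [swap_apply_self, swap_apply_self, swap_apply_of_ne _ _ _ (by simp [Fin.ext_iff]),
      swap_apply_of_ne _ _ _ (by simp [Fin.ext_iff])]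
    exact hs.2.2.2.1
  · rw [swap_apply_of_ne _ _ _ hi, swap_apply_of_ne _ _ _ hi]

lemma SatSeq.sgn_swap {x : B} {n : ℕ} (c : SatSeq x (n + 1)) (j : Fin n) :
    (c.swap e j).sgn e = -c.sgn e := by
  have hs := swapMid_spec e (c.2.2.2 j.castSucc) (c.2.2.2 j.succ)
  rw [Fin.succ_castSucc] at hs
  refine prod_eq_neg_prod (p := j.castSucc) (q := j.succ) (by simp [Fin.ext_iff]) ?_ ?_
  · rw [Fin.succ_castSucc, swap_apply_self, swap_apply_of_ne _ _ _ (by simp [Fin.ext_iff]),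
      swap_apply_of_ne _ _ _ (by simp [Fin.ext_iff])]
    exact hs.2.2.2.2
  · intro i h1 h2
    rw [swap_apply_of_ne, swap_apply_of_ne]
    · rw [← Fin.succ_castSucc]; exact fun h => h1 (Fin.succ_injective _ h)
    · exact fun h => h2 (Fin.castSucc_injective _ h)

/-- The two sequences differ only in the term that the face deletes. -/
lemma SatSeq.face_trunc_swap {x : B} {n : ℕ} (c : SatSeq x (n + 1)) (j : Fin n) :
    (c.swap e j).trunc.face j.succ = c.trunc.face j.succ := by
  refine StrictSeq.ext (funext fun i => ?_)
  exact c.swap_apply_of_ne e j fun h =>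
    Fin.succAbove_ne j.succ i (Fin.castSucc_injective _ h)

/-! ### `φ` commutes with the differentials and is natural -/

variable {R : Type v} [CommRing R] (F : B ⥤ ModuleCat.{w} R)

open scoped Classical in
/-- The image of a colour at `x` in the summand of `C_k` indexed by a sequence above `x`. -/
noncomputable def CMod.single {x : B} (a : F.obj x) {k : ℕ} (y : StrictSeq B k) : CMod F k :=
  if h : x ≤ y.toMultiSeq.head then
    DirectSum.lof R (StrictSeq B k) (fun y => F.obj y.toMultiSeq.head) y
      ((F.map (homOfLE h)).hom a)
  else 0

open scoped Classical in
lemma CMod.single_of_le {x : B} (a : F.obj x) {k : ℕ} (y : StrictSeq B k)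
    (h : x ≤ y.toMultiSeq.head) : CMod.single F a y =
      DirectSum.lof R (StrictSeq B k) (fun y => F.obj y.toMultiSeq.head) y
        ((F.map (homOfLE h)).hom a) :=
  dif_pos h

/-- By functoriality every colour map is absorbed into `CMod.single`. The colour then stays at `x`
while the head of the sequence moves, and equal sequences can be rewritten without transport between
colour modules. -/
lemma CMod.single_map {x x' : B} (h : x ≤ x') (a : F.obj x) {k : ℕ} (y : StrictSeq B k)
    (hy : x' ≤ y.toMultiSeq.head) :
    CMod.single F ((F.map (homOfLE h)).hom a) y = CMod.single F a y := by
  rw [CMod.single_of_le _ _ _ hy, CMod.single_of_le _ _ _ (h.trans hy), ← homOfLE_comp h hy,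
    F.map_comp]
  rfl

lemma CMod.d_single {x : B} (a : F.obj x) {k : ℕ} (y : StrictSeq B (k + 1))
    (hy : x ≤ y.toMultiSeq.head) :
    CMod.d F k (CMod.single F a y) =
      ∑ i : Fin (k + 1), (-1 : ℤ) ^ (i : ℕ) • CMod.single F a (y.face i) := by
  rw [CMod.single_of_le _ _ _ hy, CMod.d_lof]
  refine Finset.sum_congr rfl fun i _ => ?_
  rw [← CMod.single_of_le, CMod.single_map _ _ _ _ (y.head_le_head_face i)]

open scoped Classical in
lemma phi_lof (n : ℕ) (x : {x : B // rk e x + n = r}) [Fintype (SatSeq x.1 n)] (a : F.obj x.1) :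
    phi e F n (DirectSum.lof R {x : B // rk e x + n = r} (fun y => F.obj y.1) x a) =
      ∑ c : SatSeq x.1 n, c.sgn e • CMod.single F a c.trunc := by
  rw [phi, DirectSum.toModule_lof, LinearMap.sum_apply]
  refine Finset.sum_congr (by ext; simp) fun c _ => ?_
  rw [CMod.single_of_le _ _ _ c.head_trunc.le]
  rfl

/-- `SatSeq.swap` is an involution without fixed points that preserves the face and reverses the
sign. -/
lemma sum_single_face_succ {n : ℕ} {x : B} [Fintype (SatSeq x (n + 1))] (a : F.obj x) (j : Fin n) :
    ∑ c : SatSeq x (n + 1), c.sgn e • CMod.single F a (c.trunc.face j.succ) = 0 := by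
  refine Finset.sum_involution (fun c _ => c.swap e j) ?_ (fun c _ _ => c.swap_ne e j)
    (fun _ _ => Finset.mem_univ _) (fun c _ => c.swap_swap e j)
  intro c _
  rw [SatSeq.face_trunc_swap, SatSeq.sgn_swap, neg_smul, add_neg_cancel]

/-- A saturated sequence without its first term. -/
def SatSeq.tail {x : B} {n : ℕ} (c : SatSeq x (n + 1)) : SatSeq (c.1 1) n :=
  ⟨fun i => c.1 i.succ, rfl, c.2.2.1, fun i => by
    have := c.2.2.2 i.succ
    rwa [← Fin.succ_castSucc] at this⟩

lemma SatSeq.covBy {x : B} {n : ℕ} (c : SatSeq x (n + 1)) : x ⋖ c.1 1 := by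
  have := c.2.2.2 0
  rwa [Fin.castSucc_zero, c.2.1] at this

lemma SatSeq.sgn_tail {x : B} {n : ℕ} (c : SatSeq x (n + 1)) :
    c.sgn e = ColouredPoset.sgn e x (c.1 1) * c.tail.sgn e := by
  rw [SatSeq.sgn, Fin.prod_univ_succ, Fin.castSucc_zero, c.2.1]
  rfl

lemma SatSeq.trunc_face_zero {x : B} {n : ℕ} (c : SatSeq x (n + 1)) :
    c.trunc.face 0 = c.tail.trunc :=
  rfl

-- A saturated sequence from `x` is a cover `y` of `x` followed by a saturated sequence from `y`,
-- and its sign is the product of the two signs. Hence the faces at the first term give `φ(dλ)`.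
-- Every other face cancels, including the one at the last term of the truncated sequence, which
-- still lies below the removed `1`.
open scoped Classical in
lemma phi_comp_d (n : ℕ) : CMod.d F n ∘ₗ phi e F (n + 1) = phi e F n ∘ₗ KMod.d e F n := by
  have := finite_of_iso e
  let : Fintype B := Fintype.ofFinite _
  have (x : B) (n : ℕ) : Fintype (SatSeq x n) := Fintype.ofFinite _
  refine DirectSum.linearMap_ext R fun x => LinearMap.ext fun a => ?_
  rw [LinearMap.comp_apply, LinearMap.comp_apply, LinearMap.comp_apply, LinearMap.comp_apply,
    phi_lof, map_sum, KMod.d_lof, map_sum]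
  have h1 : ∀ c : SatSeq x.1 (n + 1), CMod.d F n (c.sgn e • CMod.single F a c.trunc) =
      ∑ i : Fin (n + 1), (-1 : ℤ) ^ (i : ℕ) • c.sgn e • CMod.single F a (c.trunc.face i) := by
    intro c
    rw [map_zsmul, CMod.d_single _ _ _ c.head_trunc.le, Finset.smul_sum]
    exact Finset.sum_congr rfl fun i _ => smul_comm _ _ _
  have h2 : ∀ y : {y : B // rk e y + n = r}, phi e F n (if h : x.1 ⋖ y.1 then
        ColouredPoset.sgn e x.1 y.1 • DirectSum.lof R {y : B // rk e y + n = r}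
          (fun y => F.obj y.1) y ((F.map (homOfLE h.le)).hom a) else 0) =
      ∑ c : SatSeq y.1 n, if x.1 ⋖ y.1 then
        (ColouredPoset.sgn e x.1 y.1 * c.sgn e) • CMod.single F a c.trunc else 0 := by
    intro y
    split_ifs with h
    · rw [map_zsmul, phi_lof, Finset.smul_sum]
      refine Finset.sum_congr rfl fun c _ => ?_
      rw [smul_smul, CMod.single_map _ _ _ _ c.head_trunc.le]
    · simp
  rw [Finset.sum_congr rfl fun c _ => h1 c, Finset.sum_congr rfl fun y _ => h2 y,
    Finset.sum_comm, Fin.sum_univ_succ]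
  simp_rw [← Finset.smul_sum]
  rw [Finset.sum_eq_zero (s := (Finset.univ : Finset (Fin n))), add_zero, Fin.val_zero, pow_zero,
    one_smul, ← Fintype.sum_sigma']
  · have hrk : ∀ c : SatSeq x.1 (n + 1), rk e (c.1 1) + n = r := fun c => by
      have h1 := rk_of_covBy e c.covBy
      have h2 := x.2
      omega
    -- The second sum runs over all `y` of the right rank; the pairs outside the image are those
    -- with `y` not covering `x`, and their terms are zero.
    refine Fintype.sum_of_injective (fun c => ⟨⟨c.1 1, hrk c⟩, c.tail⟩) ?_ _ _ ?_ ?_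
    · intro c c' h
      refine Subtype.ext (funext fun i => ?_)
      cases i using Fin.cases with
      | zero => rw [c.2.1, c'.2.1]
      | succ i =>
        have : ∀ p q : (Σ y : {y : B // rk e y + n = r}, SatSeq y.1 n), p = q →
          p.2.1 i = q.2.1 i := by rintro p _ rfl; rfl
        exact this _ _ h
    · rintro ⟨⟨y, hy⟩, c, h0, h1, h2⟩
      change c 0 = y at h0
      subst h0
      refine fun hc => if_neg fun h => hc ?_
      refine ⟨⟨Fin.cons x.1 c, rfl, h1, fun i => ?_⟩, rfl⟩
      cases i using Fin.cases with
      | zero => exact h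
      | succ i => exact h2 i
    · intro c
      dsimp only
      rw [if_pos c.covBy, SatSeq.sgn_tail, SatSeq.trunc_face_zero]
  · intro j _
    rw [sum_single_face_succ, smul_zero]

/-- The chain map `φ : K_*(B, F) ⟶ C_*(B, F)`. -/
noncomputable def phiHom : KComplex e F ⟶ CComplex F :=
  ChainComplex.ofHom (fun n => ModuleCat.ofHom (phi e F n)) fun n => by
    simp only [CComplex, KComplex, ChainComplex.of_d]
    rw [← ModuleCat.ofHom_comp, ← ModuleCat.ofHom_comp, phi_comp_d]

variable (R) in
open scoped Classical in
/-- `φ` is natural in the colouring. -/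
noncomputable def phiNatTrans : KFunctor.{u, v, w} (R := R) e ⟶ CFunctor where
  app F := phiHom e F
  naturality F G α := by
    ext n : 2
    refine DirectSum.linearMap_ext R fun x => LinearMap.ext fun a => ?_
    have := finite_of_iso e
    let : Fintype (SatSeq x.1 n) := Fintype.ofFinite _
    change phi e G n (DirectSum.lmap (fun x : {x : B // rk e x + n = r} => (α.app x.1).hom)
        (DirectSum.lof R _ _ x a)) =
      DirectSum.lmap (fun x : StrictSeq B n => (α.app x.toMultiSeq.head).hom)
        (phi e F n (DirectSum.lof R _ _ x a))
    rw [DirectSum.lmap_lof, phi_lof, phi_lof, map_sum]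
    refine Finset.sum_congr rfl fun c _ => ?_
    rw [map_zsmul, CMod.single_of_le _ _ _ c.head_trunc.le,
      CMod.single_of_le _ _ _ c.head_trunc.le, DirectSum.lmap_lof, NatTrans.naturality_apply]

end ChainMap

/-! ### Naturality of the inclusion of the reduced complex -/

section Inclusion

variable {P : Type u} [PartialOrder P] [OrderTop P] (R : Type v) [CommRing R]

open scoped Classical in
/-- The inclusion `C_*(P, F) ⊆ S_*(P, F)` is natural in the colouring. -/
noncomputable def inclNatTrans : CFunctor.{u, v, w} (R := R) (P := P) ⟶ SFunctor where
  app F := incl F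
  naturality F G α := by
    ext n : 2
    refine DirectSum.linearMap_ext R fun x => LinearMap.ext fun a => ?_
    change CMod.incl G n (DirectSum.lmap (fun x : StrictSeq P n =>
        (α.app x.toMultiSeq.head).hom) (DirectSum.lof R _ _ x a)) =
      DirectSum.lmap (fun x : MultiSeq P n => (α.app x.head).hom)
        (CMod.incl F n (DirectSum.lof R _ _ x a))
    rw [DirectSum.lmap_lof, CMod.incl_lof, CMod.incl_lof, DirectSum.lmap_lof]

end Inclusion

/-! ### Principal colourings and the reduction to them -/

section Principal

variable {R : Type v} [CommRing R] {P : Type u} [PartialOrder P]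

/-- The submodule of `M` that is everything if `z ≤ y` and zero otherwise. -/
def principalSubmodule (z : P) (M : ModuleCat.{w} R) (y : P) : Submodule R M where
  carrier := {m | ¬ z ≤ y → m = 0}
  add_mem' ha hb h := by rw [ha h, hb h, add_zero]
  zero_mem' _ := rfl
  smul_mem' c m hm h := by rw [hm h, smul_zero]

/-- The colouring freely generated by the module `M` at `z`: it is `M` on the elements above `z` and
zero elsewhere. -/
def principal (z : P) (M : ModuleCat.{w} R) : P ⥤ ModuleCat.{w} R where
  obj y := ModuleCat.of R (principalSubmodule z M y)
  map f := ModuleCat.ofHom (Submodule.inclusion fun _ hm h => hm fun h' => h (h'.trans (leOfHom f)))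
  -- All colours are submodules of the one module `M` and all maps are inclusions, so the functor
  -- laws hold by definition.
  map_id _ := rfl
  map_comp _ _ := rfl

lemma principal_subsingleton {z y : P} (h : ¬ z ≤ y) (M : ModuleCat.{w} R) :
    Subsingleton ((principal z M).obj y) :=
  ⟨fun a b => Subtype.ext ((a.2 h).trans (b.2 h).symm)⟩

/-- An element of `M` as a colour at the generating element. -/
def principalMk {z y : P} {M : ModuleCat.{w} R} (m : (principal z M).obj y) :
    (principal z M).obj z :=
  ⟨m.1, fun h => (h le_rfl).elim⟩

/-- The linear map from an arbitrary colour module of `principal z M` to one above `z`. -/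
def principalTransport {z y' : P} (h : z ≤ y') (M : ModuleCat.{w} R) (y : P) :
    (principal z M).obj y →ₗ[R] (principal z M).obj y' :=
  Submodule.inclusion fun _ _ hn => (hn h).elim

/-- The inclusion of the colours of `principal z M` in `M`. -/
def principalIncl (z : P) (M : ModuleCat.{w} R) (y : P) : (principal z M).obj y ⟶ M :=
  ModuleCat.ofHom (principalSubmodule z M y).subtype

lemma principal_map_incl {z : P} {M : ModuleCat.{w} R} {y y' : P} (f : y ⟶ y') :
    (principal z M).map f ≫ principalIncl z M y' = principalIncl z M y :=
  rfl

lemma principalIncl_self_isIso (z : P) (M : ModuleCat.{w} R) : IsIso (principalIncl z M z) :=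
  (ConcreteCategory.isIso_iff_bijective _).2
    ⟨Subtype.val_injective, fun m => ⟨⟨m, fun h => (h le_rfl).elim⟩, rfl⟩⟩

open scoped Classical in
/-- The map of colourings adjoint to the identity of `F(z)`. -/
noncomputable def principalCounit (F : P ⥤ ModuleCat.{w} R) (z : P) :
    principal z (F.obj z) ⟶ F where
  app y := if h : z ≤ y then principalIncl z (F.obj z) y ≫ F.map (homOfLE h) else 0
  naturality y y' f := by
    by_cases h : z ≤ y
    · rw [dif_pos h, dif_pos (h.trans (leOfHom f)), ← Category.assoc, principal_map_incl,
        Category.assoc, ← F.map_comp]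
      rfl
    · have := principal_subsingleton h (F.obj z)
      exact (ModuleCat.isZero_of_subsingleton _).eq_of_src _ _

/-- This makes the kernel and cokernel of the counit vanish at `z`, which drives the induction on
the support. -/
lemma principalCounit_app_self (F : P ⥤ ModuleCat.{w} R) (z : P) :
    IsIso ((principalCounit F z).app z) := by
  have h : (principalCounit F z).app z = principalIncl z (F.obj z) z := by
    rw [principalCounit]
    dsimp only
    rw [dif_pos le_rfl]
    exact (congrArg (_ ≫ ·) (F.map_id z)).trans (Category.comp_id _)
  rw [h]
  exact principalIncl_self_isIso z _

variable {A : Type*} [Category A] [Abelian A]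

/-- A natural transformation between exact functors from colourings of a finite poset to complexes
is a quasi-isomorphism if it is one on the principal colourings. -/
theorem quasiIso_app_of_principal [Finite P] {K C : (P ⥤ ModuleCat.{w} R) ⥤ ChainComplex A ℕ}
    [K.PreservesZeroMorphisms] [C.PreservesZeroMorphisms]
    (hK : ∀ {S : ShortComplex (P ⥤ ModuleCat.{w} R)}, S.ShortExact → (S.map K).ShortExact)
    (hC : ∀ {S : ShortComplex (P ⥤ ModuleCat.{w} R)}, S.ShortExact → (S.map C).ShortExact)
    (τ : K ⟶ C) (h : ∀ z M, QuasiIso (τ.app (principal z M))) (F : P ⥤ ModuleCat.{w} R) :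
    QuasiIso (τ.app F) := by
  classical
  let : Fintype P := Fintype.ofFinite P
  -- Induction on a support `U`. It is kept an upper set so that the principal colouring at a point
  -- of `U` is again supported in `U`.
  suffices H : ∀ (U : Finset P), IsUpperSet (U : Set P) → ∀ F : P ⥤ ModuleCat.{w} R,
      (∀ x ∉ U, IsZero (F.obj x)) → QuasiIso (τ.app F) from
    H Finset.univ (by simpa using isUpperSet_univ) F (by simp)
  intro U
  induction U using Finset.strongInduction with
  | H U ih =>
    intro hU F hF
    rcases U.eq_empty_or_nonempty with rfl | hne
    · have hF0 : IsZero F := Functor.isZero _ fun x => hF x (by simp)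
      have : IsIso (τ.app F) :=
        ⟨0, (K.map_isZero hF0).eq_of_src _ _, (C.map_isZero hF0).eq_of_src _ _⟩
      infer_instance
    obtain ⟨z, hz⟩ := U.exists_minimal hne
    have hU' : IsUpperSet ((U.erase z : Finset P) : Set P) := by
      intro a b hab ha
      simp only [Finset.coe_erase, Set.mem_sdiff, Finset.mem_coe, Set.mem_singleton_iff] at ha ⊢
      refine ⟨hU hab ha.1, ?_⟩
      rintro rfl
      exact ha.2 (le_antisymm hab (hz.2 ha.1 hab))
    have ih' := ih (U.erase z) (Finset.erase_ssubset hz.1) hU'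
    let α := principalCounit F z
    have hα : IsIso (α.app z) := principalCounit_app_self F z
    -- Since `α` is invertible at `z`, the first factor is mono there and the second is epi. The
    -- kernel of one and the cokernel of the other are therefore zero at `z`.
    have hfac : (factorThruImage α).app z ≫ (image.ι α).app z = α.app z := by
      rw [← NatTrans.comp_app, image.fac]
    have hmono : Mono ((factorThruImage α).app z) := mono_of_mono_fac hfac
    have hepi : Epi ((image.ι α).app z) := epi_of_epi_fac hfac
    have hker : ∀ x ∉ U.erase z, IsZero ((kernel (factorThruImage α)).obj x) := by
      intro x hx
      by_cases hxz : x = z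
      · subst hxz
        refine IsZero.of_mono_eq_zero ((kernel.ι (factorThruImage α)).app x) ?_
        rw [← cancel_mono ((factorThruImage α).app x), ← NatTrans.comp_app, kernel.condition,
          zero_comp, zero_app]
      · have hzx : ¬ z ≤ x := fun h => hx (Finset.mem_erase.2 ⟨hxz, hU h hz.1⟩)
        have := principal_subsingleton hzx (F.obj z)
        exact IsZero.of_mono ((kernel.ι (factorThruImage α)).app x)
          (ModuleCat.isZero_of_subsingleton _)
    have hcoker : ∀ x ∉ U.erase z, IsZero ((cokernel (image.ι α)).obj x) := by
      intro x hx
      by_cases hxz : x = z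
      · subst hxz
        refine IsZero.of_epi_eq_zero ((cokernel.π (image.ι α)).app x) ?_
        rw [← cancel_epi ((image.ι α).app x), ← NatTrans.comp_app, cokernel.condition,
          comp_zero, zero_app]
      · exact IsZero.of_epi ((cokernel.π (image.ι α)).app x)
          (hF x fun h => hx (Finset.mem_erase.2 ⟨hxz, h⟩))
    have h₁ : (ShortComplex.mk _ _ (kernel.condition (factorThruImage α))).ShortExact :=
      { exact := ShortComplex.exact_kernel _ }
    have h₂ : (ShortComplex.mk _ _ (cokernel.condition (image.ι α))).ShortExact :=
      { exact := ShortComplex.exact_cokernel _ }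
    -- From `kernel → principal → image`: the kernel has smaller support and the principal colouring
    -- is the hypothesis `h`. The sequence `image → F → cokernel` then settles `F`.
    have himage : QuasiIso (τ.app (image α)) :=
      HomologicalComplex.HomologySequence.quasiIso_τ₃ (ShortComplex.mapNatTrans _ τ)
        (hK h₁) (hC h₁) (ih' _ hker) (h z _)
    exact HomologicalComplex.HomologySequence.quasiIso_τ₂ (ShortComplex.mapNatTrans _ τ)
      (hK h₂) (hC h₂) himage (ih' _ hcoker)

end Principal

/-! ### Colourings concentrated at the greatest element -/

section DegreeZero

variable {R : Type v} [CommRing R]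

variable {P : Type u} [PartialOrder P] [OrderTop P]

/-- The empty sequence. -/
def StrictSeq.nil : StrictSeq P 0 :=
  ⟨⟨Fin.elim0, fun i => i.elim0, fun i => i.elim0⟩, fun i => i.elim0⟩

lemma MultiSeq.eq_nil (x : MultiSeq P 0) : x = StrictSeq.nil.toMultiSeq :=
  MultiSeq.ext (funext fun i => i.elim0)

lemma StrictSeq.eq_nil (x : StrictSeq P 0) : x = StrictSeq.nil :=
  StrictSeq.ext (funext fun i => i.elim0)

lemma directSum_subsingleton {ι : Type*} {M : ι → Type*} [∀ i, AddCommGroup (M i)]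
    (h : ∀ i, Subsingleton (M i)) : Subsingleton (⨁ i, M i) :=
  ⟨fun _ _ => DFinsupp.ext fun _ => Subsingleton.elim _ _⟩

-- The empty sequence is the only index in degree 0, so both modules are copies of `F(1)`.
open scoped Classical in
lemma incl_f_zero_isIso (F : P ⥤ ModuleCat.{w} R) : IsIso ((incl F).f 0) := by
  change IsIso (ModuleCat.ofHom (CMod.incl F 0))
  let ψ : SMod F 0 →ₗ[R] CMod F 0 := DirectSum.toModule R _ _ fun _ =>
    DirectSum.lof R (StrictSeq P 0) (fun y => F.obj y.toMultiSeq.head) StrictSeq.nil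
  have hψ (a : F.obj (⊤ : P)) : ψ (DirectSum.lof R (MultiSeq P 0) (fun y => F.obj y.head)
        StrictSeq.nil.toMultiSeq a) =
      DirectSum.lof R (StrictSeq P 0) (fun y => F.obj y.toMultiSeq.head) StrictSeq.nil a :=
    DirectSum.toModule_lof R (M := fun y : MultiSeq P 0 => F.obj y.head)
      StrictSeq.nil.toMultiSeq a
  refine ⟨ModuleCat.ofHom ψ, ?_, ?_⟩
  · ext : 1
    refine DirectSum.linearMap_ext R fun x => LinearMap.ext fun a => ?_
    obtain rfl := x.eq_nil
    change ψ (CMod.incl F 0 (DirectSum.lof R (StrictSeq P 0) (fun y => F.obj y.toMultiSeq.head)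
        StrictSeq.nil a)) =
      DirectSum.lof R (StrictSeq P 0) (fun y => F.obj y.toMultiSeq.head) StrictSeq.nil a
    rw [CMod.incl_lof]
    exact hψ a
  · ext : 1
    refine DirectSum.linearMap_ext R fun x => LinearMap.ext fun a => ?_
    obtain rfl := x.eq_nil
    change CMod.incl F 0 (ψ (DirectSum.lof R (MultiSeq P 0) (fun y => F.obj y.head)
        StrictSeq.nil.toMultiSeq a)) =
      DirectSum.lof R (MultiSeq P 0) (fun y => F.obj y.head) StrictSeq.nil.toMultiSeq a
    exact (congrArg _ (hψ a)).trans (CMod.incl_lof F 0 StrictSeq.nil a)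

variable {r : ℕ} (e : P ≃o Finset (Fin r))

lemma rk_top : rk e (⊤ : P) + 0 = r := by
  rw [rk, map_top, add_zero, Finset.top_eq_univ, Finset.card_univ, Fintype.card_fin]

lemma eq_top_of_rk {x : P} (h : rk e x + 0 = r) : x = ⊤ := by
  apply e.injective
  rw [map_top, Finset.top_eq_univ, ← Finset.card_eq_iff_eq_univ, Fintype.card_fin]
  exact h

-- The only saturated sequence of length zero is the constant one at `1`; its sign is an empty
-- product and its truncation is empty.
open scoped Classical in
lemma phi_zero_lof (F : P ⥤ ModuleCat.{w} R) (a : F.obj (⊤ : P)) :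
    phi e F 0 (DirectSum.lof R {x : P // rk e x + 0 = r} (fun y => F.obj y.1) ⟨⊤, rk_top e⟩ a) =
      DirectSum.lof R (StrictSeq P 0) (fun y => F.obj y.toMultiSeq.head) StrictSeq.nil a := by
  let : Unique (SatSeq (⊤ : P) 0) :=
    { default := ⟨fun _ => ⊤, rfl, rfl, fun i => i.elim0⟩
      uniq c := Subtype.ext (funext fun i =>
        (congrArg c.1 (Subsingleton.elim (α := Fin 1) i 0)).trans c.2.1) }
  rw [phi_lof, Fintype.sum_unique, SatSeq.sgn, Fin.prod_univ_zero, one_smul,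
    CMod.single_of_le _ _ _ (SatSeq.head_trunc _).le]
  have h : ((F.map (𝟙 (⊤ : P))).hom a) = a := by rw [F.map_id]; rfl
  conv_rhs => rw [← h]
  rw [StrictSeq.eq_nil (SatSeq.trunc _)]
  rfl

open scoped Classical in
lemma phiHom_f_zero_isIso (F : P ⥤ ModuleCat.{w} R) : IsIso ((phiHom e F).f 0) := by
  change IsIso (ModuleCat.ofHom (phi e F 0))
  let ψ : CMod F 0 →ₗ[R] KMod e F 0 := DirectSum.toModule R _ _ fun _ =>
    DirectSum.lof R {x : P // rk e x + 0 = r} (fun y => F.obj y.1) ⟨⊤, rk_top e⟩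
  have hψ (a : F.obj (⊤ : P)) :
      ψ (DirectSum.lof R (StrictSeq P 0) (fun y => F.obj y.toMultiSeq.head) StrictSeq.nil a) =
        DirectSum.lof R {x : P // rk e x + 0 = r} (fun y => F.obj y.1) ⟨⊤, rk_top e⟩ a :=
    DirectSum.toModule_lof R (M := fun y : StrictSeq P 0 => F.obj y.toMultiSeq.head)
      StrictSeq.nil a
  refine ⟨ModuleCat.ofHom ψ, ?_, ?_⟩
  · ext : 1
    refine DirectSum.linearMap_ext R fun x => LinearMap.ext fun a => ?_
    obtain ⟨x, hx⟩ := x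
    obtain rfl := eq_top_of_rk e hx
    change ψ (phi e F 0 (DirectSum.lof R {x : P // rk e x + 0 = r} (fun y => F.obj y.1) _ a)) =
      DirectSum.lof R {x : P // rk e x + 0 = r} (fun y => F.obj y.1) _ a
    exact (congrArg _ (phi_zero_lof e F a)).trans (hψ a)
  · ext : 1
    refine DirectSum.linearMap_ext R fun x => LinearMap.ext fun a => ?_
    obtain rfl := x.eq_nil
    change phi e F 0 (ψ (DirectSum.lof R (StrictSeq P 0) (fun y => F.obj y.toMultiSeq.head)
        StrictSeq.nil a)) =
      DirectSum.lof R (StrictSeq P 0) (fun y => F.obj y.toMultiSeq.head) StrictSeq.nil a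
    exact (congrArg _ (hψ a)).trans (phi_zero_lof e F a)

lemma MultiSeq.head_ne_top {n : ℕ} (x : MultiSeq P (n + 1)) : x.head ≠ ⊤ := x.ne_top 0

lemma isIso_of_subsingleton {X Y : ModuleCat.{w} R} (f : X ⟶ Y) (hX : Subsingleton X)
    (hY : Subsingleton Y) : IsIso f :=
  (ModuleCat.isZero_of_subsingleton X).isIso (ModuleCat.isZero_of_subsingleton Y) f

/-- For colourings concentrated at `1` the inclusion `C_* ⊆ S_*` is an isomorphism. -/
lemma incl_quasiIso_of_concentrated (F : P ⥤ ModuleCat.{w} R)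
    (hF : ∀ x, x ≠ ⊤ → Subsingleton (F.obj x)) : QuasiIso (incl F) := by
  have (n : ℕ) : IsIso ((incl F).f n) := by
    cases n with
    | zero => exact incl_f_zero_isIso F
    | succ n =>
      exact isIso_of_subsingleton _ (directSum_subsingleton fun x => hF _ x.head_ne_top)
        (directSum_subsingleton fun x => hF _ x.head_ne_top)
  have := HomologicalComplex.Hom.isIso_of_components (incl F)
  infer_instance

/-- For colourings concentrated at `1` the map `φ` is an isomorphism. -/
lemma phiHom_quasiIso_of_concentrated (F : P ⥤ ModuleCat.{w} R)
    (hF : ∀ x, x ≠ ⊤ → Subsingleton (F.obj x)) : QuasiIso (phiHom e F) := by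
  have (n : ℕ) : IsIso ((phiHom e F).f n) := by
    cases n with
    | zero => exact phiHom_f_zero_isIso e F
    | succ n =>
      refine isIso_of_subsingleton _ (directSum_subsingleton fun x => hF _ ?_)
        (directSum_subsingleton fun x => hF _ x.head_ne_top)
      intro h
      have h1 := x.2
      have h2 := rk_top e
      rw [h] at h1
      omega
  have := HomologicalComplex.Hom.isIso_of_components (phiHom e F)
  infer_instance

end DegreeZero

/-! ### Contractions of `C` and `S` for principal colourings -/

section Contraction

variable {R : Type v} [CommRing R] {P : Type u} [PartialOrder P] [OrderTop P]

/-- Put a term in front of a multi-sequence. -/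
def MultiSeq.cons (z : P) {k : ℕ} (y : MultiSeq P k) (h : z ≤ y.head) (hz : z ≠ ⊤) :
    MultiSeq P (k + 1) where
  seq := Fin.cons z y.seq
  monotone := by
    cases k with
    | zero => exact Subsingleton.monotone (α := Fin 1) _
    | succ k =>
      refine Fin.monotone_iff_le_succ.2 fun i => ?_
      cases i using Fin.cases with
      | zero => exact h
      | succ i =>
        rw [← Fin.succ_castSucc, Fin.cons_succ, Fin.cons_succ]
        exact y.monotone i.castSucc_le_succ
  ne_top i := by
    cases i using Fin.cases with
    | zero => exact hz
    | succ i => exact y.ne_top i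

lemma MultiSeq.cons_face_zero (z : P) {k : ℕ} (y : MultiSeq P k) (h : z ≤ y.head) (hz : z ≠ ⊤) :
    (y.cons z h hz).face 0 = y :=
  MultiSeq.ext (funext fun _ => by
    change Fin.cons (α := fun _ => P) z y.seq (Fin.succAbove 0 _) = _
    rw [Fin.succAbove_zero, Fin.cons_succ])

lemma MultiSeq.cons_face_succ (z : P) {k : ℕ} (y : MultiSeq P (k + 1)) (h : z ≤ y.head) (hz : z ≠ ⊤)
    (i : Fin (k + 1)) :
    (y.cons z h hz).face i.succ = (y.face i).cons z (h.trans (y.head_le_head_face i)) hz :=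
  MultiSeq.ext (funext fun j => by
    change Fin.cons (α := fun _ => P) z y.seq (Fin.succAbove i.succ j) =
      Fin.cons (α := fun _ => P) z (y.seq ∘ i.succAbove) j
    cases j using Fin.cases with
    | zero => rfl
    | succ j => rw [Fin.succ_succAbove_succ, Fin.cons_succ, Fin.cons_succ]; rfl)

/-- Put a term in front of a strict sequence. -/
def StrictSeq.cons (z : P) {k : ℕ} (y : StrictSeq P k) (h : z < y.toMultiSeq.head) :
    StrictSeq P (k + 1) where
  toMultiSeq := y.toMultiSeq.cons z h.le (h.trans_le le_top).ne
  strictMono := by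
    cases k with
    | zero => exact Subsingleton.strictMono (α := Fin 1) _
    | succ k =>
      refine Fin.strictMono_iff_lt_succ.2 fun i => ?_
      change Fin.cons (α := fun _ => P) z y.seq i.castSucc <
        Fin.cons (α := fun _ => P) z y.seq i.succ
      cases i using Fin.cases with
      | zero => exact h
      | succ i =>
        rw [← Fin.succ_castSucc, Fin.cons_succ, Fin.cons_succ]
        exact y.strictMono i.castSucc_lt_succ

lemma StrictSeq.cons_face_zero (z : P) {k : ℕ} (y : StrictSeq P k) (h : z < y.toMultiSeq.head) :
    (y.cons z h).face 0 = y :=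
  StrictSeq.ext (funext fun _ => by
    change Fin.cons (α := fun _ => P) z y.seq (Fin.succAbove 0 _) = _
    rw [Fin.succAbove_zero, Fin.cons_succ])

lemma StrictSeq.cons_face_succ (z : P) {k : ℕ} (y : StrictSeq P (k + 1)) (h : z < y.toMultiSeq.head)
    (i : Fin (k + 1)) :
    (y.cons z h).face i.succ = (y.face i).cons z (h.trans_le (y.head_le_head_face i)) :=
  StrictSeq.ext (funext fun j => by
    change Fin.cons (α := fun _ => P) z y.seq (Fin.succAbove i.succ j) =
      Fin.cons (α := fun _ => P) z (y.seq ∘ i.succAbove) j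
    cases j using Fin.cases with
    | zero => rfl
    | succ j => rw [Fin.succ_succAbove_succ, Fin.cons_succ, Fin.cons_succ]; rfl)

variable (z : P) (M : ModuleCat.{w} R)

/-- Where `z` is below the head, each colour is the image of one at `z`; all other summands vanish.
-/
lemma CMod.principal_ext {N : Type*} [AddCommGroup N] [Module R N] {k : ℕ}
    {f g : CMod (principal z M) k →ₗ[R] N}
    (h : ∀ (a : (principal z M).obj z) (y : StrictSeq P k), z ≤ y.toMultiSeq.head →
      f (CMod.single _ a y) = g (CMod.single _ a y)) : f = g := by
  classical
  refine DirectSum.linearMap_ext R fun y => LinearMap.ext fun m => ?_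
  by_cases hy : z ≤ y.toMultiSeq.head
  · have := h (principalMk m) y hy
    rwa [CMod.single_of_le _ _ _ hy] at this
  · have := principal_subsingleton hy M
    rw [Subsingleton.elim m 0, map_zero, map_zero]

open scoped Classical in
/-- The contraction of `C_*` of a principal colouring. -/
noncomputable def CMod.contract (k : ℕ) :
    CMod (principal z M) k →ₗ[R] CMod (principal z M) (k + 1) :=
  DirectSum.toModule R _ _ fun y =>
    if h : z < y.toMultiSeq.head then
      DirectSum.lof R (StrictSeq P (k + 1)) (fun y => (principal z M).obj y.toMultiSeq.head)
        (y.cons z h) ∘ₗ principalTransport (y' := (y.cons z h).toMultiSeq.head)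
          le_rfl M y.toMultiSeq.head
    else 0

variable {z M}

lemma CMod.contract_single_of_lt (a : (principal z M).obj z) {k : ℕ} (y : StrictSeq P k)
    (h : z < y.toMultiSeq.head) :
    CMod.contract z M k (CMod.single _ a y) = CMod.single _ a (y.cons z h) := by
  classical
  rw [CMod.single_of_le _ _ _ h.le, CMod.contract, DirectSum.toModule_lof, dif_pos h,
    CMod.single_of_le _ (x := z) _ (y.cons z h) le_rfl]
  rfl

lemma CMod.contract_single_of_eq (a : (principal z M).obj z) {k : ℕ} (y : StrictSeq P k)
    (h : z = y.toMultiSeq.head) : CMod.contract z M k (CMod.single _ a y) = 0 := by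
  classical
  rw [CMod.single_of_le _ _ _ h.le, CMod.contract, DirectSum.toModule_lof, dif_neg h.not_lt]
  rfl

/-- The empty sequence has head `1`, so `z ≠ 1` is what allows `z` to be put in front of it. -/
lemma CMod.d_contract_zero (hz : z ≠ ⊤) :
    CMod.d (principal z M) 0 ∘ₗ CMod.contract z M 0 = LinearMap.id := by
  refine CMod.principal_ext z M fun a y hy => ?_
  have h : z < y.toMultiSeq.head := hz.lt_top
  rw [LinearMap.comp_apply, LinearMap.id_apply, CMod.contract_single_of_lt _ _ h,
    CMod.d_single _ _ (x := z) _ le_rfl, Fin.sum_univ_one, StrictSeq.cons_face_zero]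
  simp

/-- If `z` lies strictly below the head, this is the usual cone identity. If the sequence already
starts with `z`, its contraction is zero; deleting `z` and putting it back recovers the sequence,
and the other faces still start with `z`, so they contract to zero. -/
lemma CMod.d_contract_succ (k : ℕ) :
    CMod.d (principal z M) (k + 1) ∘ₗ CMod.contract z M (k + 1) +
      CMod.contract z M k ∘ₗ CMod.d (principal z M) k = LinearMap.id := by
  refine CMod.principal_ext z M fun a y hy => ?_
  rw [LinearMap.add_apply, LinearMap.comp_apply, LinearMap.comp_apply, LinearMap.id_apply,
    CMod.d_single _ _ _ hy, map_sum]
  simp only [map_zsmul]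
  rcases hy.lt_or_eq with h | h
  · rw [CMod.contract_single_of_lt _ _ h, CMod.d_single _ _ (x := z) _ le_rfl, Fin.sum_univ_succ,
      StrictSeq.cons_face_zero, Fin.val_zero, pow_zero, one_smul, add_assoc,
      ← Finset.sum_add_distrib, Finset.sum_eq_zero, add_zero]
    intro i _
    rw [StrictSeq.cons_face_succ,
      CMod.contract_single_of_lt _ _ (h.trans_le (y.head_le_head_face i)), Fin.val_succ, pow_succ]
    simp
  -- For `k = 0` the face is empty and its head is `1`, so the strict inequality comes from the head
  -- of `y` not being `1`.
  · have h0 : z < (y.face 0).toMultiSeq.head := by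
      rw [h]
      cases k with
      | zero => exact y.toMultiSeq.head_ne_top.lt_top
      | succ k => exact y.strictMono (Fin.succAbove_ne 0 0).bot_lt
    rw [CMod.contract_single_of_eq _ _ h, map_zero, zero_add, Fin.sum_univ_succ,
      CMod.contract_single_of_lt _ _ h0, Finset.sum_eq_zero, add_zero, Fin.val_zero, pow_zero,
      one_smul]
    · congr 1
      refine StrictSeq.ext (funext fun j => ?_)
      change Fin.cons (α := fun _ => P) z (y.seq ∘ Fin.succAbove 0) j = y.seq j
      cases j using Fin.cases with
      | zero => exact h
      | succ j => simp
    · intro i _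
      rw [CMod.contract_single_of_eq, smul_zero]
      rw [h]
      cases k with
      | zero => exact i.elim0
      | succ k => exact congrArg y.seq (Fin.succAbove_ne_zero_zero (Fin.succ_ne_zero i)).symm

/-- `C_*` of a principal colouring that is not generated at `1` is acyclic. -/
lemma CComplex_principal_acyclic (hz : z ≠ ⊤) : (CComplex (principal z M)).Acyclic :=
  ChainComplex.of_acyclic_of_contraction _ _
    (fun k => by rw [← ModuleCat.ofHom_comp, CMod.d_comp_d]; rfl) (fun k => CMod.contract z M k)
    (fun x => LinearMap.congr_fun (CMod.d_contract_zero hz) x)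
    (fun k x => LinearMap.congr_fun (CMod.d_contract_succ k) x) fun _ => map_zero _

open scoped Classical in
/-- The image of a colour at `x` in the summand of `S_k` indexed by a multi-sequence above `x`. -/
noncomputable def SMod.single (F : P ⥤ ModuleCat.{w} R) {x : P} (a : F.obj x) {k : ℕ}
    (y : MultiSeq P k) : SMod F k :=
  if h : x ≤ y.head then
    DirectSum.lof R (MultiSeq P k) (fun y => F.obj y.head) y ((F.map (homOfLE h)).hom a)
  else 0

open scoped Classical in
lemma SMod.single_of_le (F : P ⥤ ModuleCat.{w} R) {x : P} (a : F.obj x) {k : ℕ}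
    (y : MultiSeq P k) (h : x ≤ y.head) : SMod.single F a y =
      DirectSum.lof R (MultiSeq P k) (fun y => F.obj y.head) y ((F.map (homOfLE h)).hom a) :=
  dif_pos h

lemma SMod.d_single (F : P ⥤ ModuleCat.{w} R) {x : P} (a : F.obj x) {k : ℕ}
    (y : MultiSeq P (k + 1)) (hy : x ≤ y.head) :
    SMod.d F k (SMod.single F a y) =
      ∑ i : Fin (k + 1), (-1 : ℤ) ^ (i : ℕ) • SMod.single F a (y.face i) := by
  rw [SMod.single_of_le _ _ _ hy, SMod.d_lof]
  refine Finset.sum_congr rfl fun i _ => ?_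
  rw [SMod.single_of_le _ _ _ (hy.trans (y.head_le_head_face i)),
    ← homOfLE_comp hy (y.head_le_head_face i), F.map_comp]
  rfl

lemma SMod.principal_ext {N : Type*} [AddCommGroup N] [Module R N] {k : ℕ}
    {f g : SMod (principal z M) k →ₗ[R] N}
    (h : ∀ (a : (principal z M).obj z) (y : MultiSeq P k), z ≤ y.head →
      f (SMod.single _ a y) = g (SMod.single _ a y)) : f = g := by
  classical
  refine DirectSum.linearMap_ext R fun y => LinearMap.ext fun m => ?_
  by_cases hy : z ≤ y.head
  · have := h (principalMk m) y hy
    rwa [SMod.single_of_le _ _ _ hy] at this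
  · have := principal_subsingleton hy M
    rw [Subsingleton.elim m 0, map_zero, map_zero]

variable (M) in
open scoped Classical in
/-- The contraction of `S_*` of a principal colouring. -/
noncomputable def SMod.contract (hz : z ≠ ⊤) (k : ℕ) :
    SMod (principal z M) k →ₗ[R] SMod (principal z M) (k + 1) :=
  DirectSum.toModule R _ _ fun y =>
    if h : z ≤ y.head then
      DirectSum.lof R (MultiSeq P (k + 1)) (fun y => (principal z M).obj y.head)
        (y.cons z h hz) ∘ₗ principalTransport (y' := (y.cons z h hz).head) le_rfl M y.head
    else 0

lemma SMod.contract_single (hz : z ≠ ⊤) (a : (principal z M).obj z) {k : ℕ} (y : MultiSeq P k)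
    (h : z ≤ y.head) :
    SMod.contract M hz k (SMod.single _ a y) = SMod.single _ a (y.cons z h hz) := by
  classical
  rw [SMod.single_of_le _ _ _ h, SMod.contract, DirectSum.toModule_lof, dif_pos h,
    SMod.single_of_le _ (x := z) _ (y.cons z h hz) le_rfl]
  rfl

lemma SMod.d_contract_zero (hz : z ≠ ⊤) :
    SMod.d (principal z M) 0 ∘ₗ SMod.contract M hz 0 = LinearMap.id := by
  refine SMod.principal_ext fun a y hy => ?_
  rw [LinearMap.comp_apply, LinearMap.id_apply, SMod.contract_single _ _ _ hy,
    SMod.d_single _ _ (x := z) _ le_rfl, Fin.sum_univ_one, MultiSeq.cons_face_zero]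
  simp

/-- Repetitions are allowed, so `z` can be put in front of every multi-sequence above it, and the
cone identity needs no case distinction. -/
lemma SMod.d_contract_succ (hz : z ≠ ⊤) (k : ℕ) :
    SMod.d (principal z M) (k + 1) ∘ₗ SMod.contract M hz (k + 1) +
      SMod.contract M hz k ∘ₗ SMod.d (principal z M) k = LinearMap.id := by
  refine SMod.principal_ext fun a y hy => ?_
  rw [LinearMap.add_apply, LinearMap.comp_apply, LinearMap.comp_apply, LinearMap.id_apply,
    SMod.d_single _ _ _ hy, map_sum]
  simp only [map_zsmul]
  rw [SMod.contract_single _ _ _ hy, SMod.d_single _ _ (x := z) _ le_rfl, Fin.sum_univ_succ,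
    MultiSeq.cons_face_zero, Fin.val_zero, pow_zero, one_smul, add_assoc,
    ← Finset.sum_add_distrib, Finset.sum_eq_zero, add_zero]
  intro i _
  rw [MultiSeq.cons_face_succ,
    SMod.contract_single _ _ _ (hy.trans (y.head_le_head_face i)), Fin.val_succ, pow_succ]
  simp

/-- `S_*` of a principal colouring that is not generated at `1` is acyclic. -/
lemma SComplex_principal_acyclic (hz : z ≠ ⊤) : (SComplex (principal z M)).Acyclic :=
  ChainComplex.of_acyclic_of_contraction _ _
    (fun k => by rw [← ModuleCat.ofHom_comp, SMod.d_comp_d]; rfl) (fun k => SMod.contract M hz k)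
    (fun x => LinearMap.congr_fun (SMod.d_contract_zero hz) x)
    (fun k x => LinearMap.congr_fun (SMod.d_contract_succ hz k) x) fun _ => map_zero _

end Contraction

/-! ### Contraction of the cube complex for principal colourings -/

section CubeContraction

variable {R : Type v} [CommRing R] {B : Type u} [PartialOrder B] {r : ℕ} (e : B ≃o Finset (Fin r))

/-- The sign `(-1)^j`, where `j` is the number of elements of `insert l t` before `l`. -/
def insertSign (t : Finset (Fin r)) (l : Fin r) : ℤ := (-1) ^ signExponent t (insert l t)

lemma insertSign_mul_self (t : Finset (Fin r)) (l : Fin r) :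
    insertSign t l * insertSign t l = 1 := by
  rw [insertSign, ← mul_pow]; simp

/-- Anticommutation of squares, rearranged using that signs square to one. The two products are the
coefficients that arise when the atom `m` is added after or before the removal of `l`. -/
lemma insertSign_square {t : Finset (Fin r)} {l m : Fin r} (hl : l ∉ t) (hm : m ∉ t)
    (hlm : l ≠ m) :
    insertSign t m * insertSign t l + insertSign (insert m t) l * insertSign (insert l t) m = 0 := by
  have h := signExponent_square hl hm hlm
  change insertSign t l * insertSign (insert l t) m +
    insertSign t m * insertSign (insert m t) l = 0 at h
  have h1 := insertSign_mul_self t m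
  have h2 := insertSign_mul_self (insert l t) m
  linear_combination insertSign t m * insertSign (insert l t) m * h -
    insertSign t m * insertSign t l * h2 -
    insertSign (insert m t) l * insertSign (insert l t) m * h1

open scoped Classical in
/-- The map of the colours at `x` to the summand of `K_k` indexed by an element above `x`, which is
given by the set of its atoms. -/
noncomputable def KMod.single (F : B ⥤ ModuleCat.{w} R) (x : B) (k : ℕ) (t : Finset (Fin r)) :
    F.obj x →ₗ[R] KMod e F k :=
  if h : x ≤ e.symm t ∧ rk e (e.symm t) + k = r then
    DirectSum.lof R {y : B // rk e y + k = r} (fun y => F.obj y.1) ⟨e.symm t, h.2⟩ ∘ₗ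
      (F.map (homOfLE h.1)).hom
  else 0

open scoped Classical in
lemma KMod.single_of_le (F : B ⥤ ModuleCat.{w} R) {x : B} (a : F.obj x) {k : ℕ}
    {t : Finset (Fin r)} (h : x ≤ e.symm t) (hk : rk e (e.symm t) + k = r) :
    KMod.single e F x k t a =
      DirectSum.lof R {y : B // rk e y + k = r} (fun y => F.obj y.1) ⟨e.symm t, hk⟩
        ((F.map (homOfLE h)).hom a) := by
  rw [KMod.single, dif_pos ⟨h, hk⟩]
  rfl

lemma rk_symm (t : Finset (Fin r)) : rk e (e.symm t) = t.card := by
  rw [rk, OrderIso.apply_symm_apply]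

lemma covBy_symm_insert {t : Finset (Fin r)} {l : Fin r} (hl : l ∉ t) :
    e.symm t ⋖ e.symm (insert l t) := by
  rw [apply_covBy_apply_iff]
  exact Finset.covBy_iff_exists_insert.2 ⟨l, hl, rfl⟩

/-- The covers of an element correspond to the atoms not below it, so the differential becomes a sum
over the complement of `t`. -/
lemma KMod.d_single (F : B ⥤ ModuleCat.{w} R) {x : B} (a : F.obj x) {k : ℕ} {t : Finset (Fin r)}
    (h : x ≤ e.symm t) (hk : rk e (e.symm t) + (k + 1) = r) :
    KMod.d e F k (KMod.single e F x (k + 1) t a) =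
      ∑ l ∈ tᶜ, insertSign t l • KMod.single e F x k (insert l t) a := by
  classical
  have := finite_of_iso e
  let : Fintype {y : B // rk e y + k = r} := Fintype.ofFinite _
  have hl (l : (tᶜ : Finset (Fin r))) : l.1 ∉ t := Finset.mem_compl.1 l.2
  have hcov (l : (tᶜ : Finset (Fin r))) := covBy_symm_insert e (hl l)
  have hrk (l : (tᶜ : Finset (Fin r))) : rk e (e.symm (insert l.1 t)) + k = r := by
    have := rk_of_covBy e (hcov l)
    omega
  rw [KMod.single_of_le e F a h hk, KMod.d_lof, ← Finset.sum_coe_sort tᶜ]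
  refine Eq.symm (Fintype.sum_of_injective (fun l => ⟨e.symm (insert l.1 t), hrk l⟩) ?_ _ _ ?_ ?_)
  · intro l l' hll
    have h1 : insert l.1 t = insert l'.1 t := e.symm.injective (congrArg Subtype.val hll)
    have h2 : l.1 ∈ insert l'.1 t := h1 ▸ Finset.mem_insert_self _ _
    exact Subtype.ext ((Finset.mem_insert.1 h2).resolve_right (hl l))
  · rintro ⟨y, hy⟩ hyl
    refine dif_neg fun hc => hyl ?_
    have hc' : t ⋖ e y := by
      rw [← apply_covBy_apply_iff e, OrderIso.apply_symm_apply] at hc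
      exact hc
    obtain ⟨l, hl, hly⟩ := Finset.covBy_iff_exists_insert.1 hc'
    refine ⟨⟨l, Finset.mem_compl.2 hl⟩, Subtype.ext ?_⟩
    change e.symm (insert l t) = y
    rw [hly, OrderIso.symm_apply_apply]
  · intro l
    rw [dif_pos (hcov l), KMod.single_of_le e F a (h.trans (hcov l).le) (hrk l), sgn,
      OrderIso.apply_symm_apply, OrderIso.apply_symm_apply, ← homOfLE_comp h (hcov l).le,
      F.map_comp]
    rfl

variable (z : B) (M : ModuleCat.{w} R)

lemma KMod.principal_ext {N : Type*} [AddCommGroup N] [Module R N] {k : ℕ}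
    {f g : KMod e (principal z M) k →ₗ[R] N}
    (h : ∀ (a : (principal z M).obj z) (t : Finset (Fin r)), z ≤ e.symm t →
      rk e (e.symm t) + k = r →
      f (KMod.single e _ z k t a) = g (KMod.single e _ z k t a)) : f = g := by
  classical
  refine DirectSum.linearMap_ext R fun y => LinearMap.ext fun m => ?_
  obtain ⟨y, hy⟩ := y
  obtain ⟨t, rfl⟩ := e.symm.surjective y
  by_cases hz : z ≤ e.symm t
  · have := h (principalMk m) t hz hy
    rwa [KMod.single_of_le e _ _ hz hy] at this
  · have := principal_subsingleton hz M
    rw [Subsingleton.elim m 0, map_zero, map_zero]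

/-- The contraction of `K_*` of a principal colouring: remove the atom with index `l`. -/
noncomputable def KMod.contract (l : Fin r) (k : ℕ) :
    KMod e (principal z M) k →ₗ[R] KMod e (principal z M) (k + 1) :=
  haveI := Classical.decEq B
  DirectSum.toModule R _ _ fun y =>
    if l ∈ e y.1 then
      insertSign ((e y.1).erase l) l •
        (KMod.single e (principal z M) z (k + 1) ((e y.1).erase l) ∘ₗ
          principalTransport le_rfl M y.1)
    else 0

variable {z M}

lemma KMod.contract_single {l : Fin r} (a : (principal z M).obj z) {k : ℕ} {t : Finset (Fin r)}
    (h : z ≤ e.symm t) (hk : rk e (e.symm t) + k = r) :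
    KMod.contract e z M l k (KMod.single e _ z k t a) =
      if l ∈ t then insertSign (t.erase l) l • KMod.single e _ z (k + 1) (t.erase l) a else 0 := by
  classical
  rw [KMod.single_of_le e _ _ h hk, KMod.contract]
  refine (DirectSum.toModule_lof R _ _).trans ?_
  rw [OrderIso.apply_symm_apply]
  split_ifs <;> rfl

variable {l : Fin r} (hl : l ∉ e z)

-- This is where the choice of an atom not below `z` enters: removing it does not leave the part
-- above `z`, where the colouring lives.
include hl in
lemma le_symm_erase {t : Finset (Fin r)} (h : z ≤ e.symm t) : z ≤ e.symm (t.erase l) :=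
  e.le_symm_apply.2 (Finset.subset_erase.2 ⟨e.le_symm_apply.1 h, hl⟩)

lemma KMod.contract_d_single (a : (principal z M).obj z) {k : ℕ} {t : Finset (Fin r)}
    (h : z ≤ e.symm t) (hk : rk e (e.symm t) + (k + 1) = r) :
    KMod.contract e z M l k (KMod.d e _ k (KMod.single e _ z (k + 1) t a)) =
      ∑ m ∈ tᶜ, insertSign t m • if l ∈ insert m t then
        insertSign ((insert m t).erase l) l •
          KMod.single e (principal z M) z (k + 1) ((insert m t).erase l) a else 0 := by
  rw [KMod.d_single e _ a h hk, map_sum]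
  refine Finset.sum_congr rfl fun m hm => ?_
  have hcov := covBy_symm_insert e (Finset.mem_compl.1 hm)
  have hrk := rk_of_covBy e hcov
  rw [map_zsmul, KMod.contract_single e a (h.trans hcov.le) (by omega)]

include hl in
lemma KMod.d_contract_single (a : (principal z M).obj z) {k : ℕ} {t : Finset (Fin r)}
    (h : z ≤ e.symm t) (hk : rk e (e.symm t) + k = r) (hlt : l ∈ t) :
    KMod.d e _ k (KMod.contract e z M l k (KMod.single e _ z k t a)) =
      KMod.single e _ z k t a + ∑ m ∈ tᶜ, (insertSign (t.erase l) l * insertSign (t.erase l) m) •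
        KMod.single e (principal z M) z k (insert m (t.erase l)) a := by
  have hrk : rk e (e.symm (t.erase l)) + (k + 1) = r := by
    have := Finset.card_erase_add_one hlt
    rw [rk_symm] at hk ⊢
    omega
  -- The complement of `t.erase l` is `insert l tᶜ`; adding `l` back gives the term `t` with the
  -- square of a sign.
  rw [KMod.contract_single e a h hk, if_pos hlt, map_zsmul,
    KMod.d_single e _ a (le_symm_erase e hl h) hrk, Finset.compl_erase,
    Finset.sum_insert (by simpa using hlt), Finset.insert_erase hlt, smul_add, smul_smul,
    insertSign_mul_self, one_smul, Finset.smul_sum]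
  simp only [smul_smul]

include hl in
lemma KMod.d_contract_zero :
    KMod.d e (principal z M) 0 ∘ₗ KMod.contract e z M l 0 = LinearMap.id := by
  refine KMod.principal_ext e z M fun a t h hk => ?_
  -- In degree 0 only the full set occurs, so there is no other atom to add and the error sum is
  -- empty.
  have ht : t = Finset.univ := by
    rwa [rk_symm, add_zero, ← Finset.card_eq_iff_eq_univ, Fintype.card_fin] at *
  rw [LinearMap.comp_apply, KMod.d_contract_single e hl a h hk (ht ▸ Finset.mem_univ l)]
  simp [ht]

-- If `l ∈ t`, the two composites agree up to sign on the terms that add an atom `m ≠ l`, and these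
-- cancel. If `l ∉ t`, the contraction kills `t`, and after the differential it kills every term
-- except the one that adds `l`.
include hl in
lemma KMod.d_contract_succ (k : ℕ) :
    KMod.d e (principal z M) (k + 1) ∘ₗ KMod.contract e z M l (k + 1) +
      KMod.contract e z M l k ∘ₗ KMod.d e (principal z M) k = LinearMap.id := by
  refine KMod.principal_ext e z M fun a t h hk => ?_
  rw [LinearMap.add_apply, LinearMap.comp_apply, LinearMap.comp_apply, LinearMap.id_apply,
    KMod.contract_d_single e a h hk]
  by_cases hlt : l ∈ t
  · rw [KMod.d_contract_single e hl a h hk hlt, add_assoc, ← Finset.sum_add_distrib,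
      Finset.sum_eq_zero, add_zero]
    intro m hm
    rw [Finset.mem_compl] at hm
    have hml : m ≠ l := by rintro rfl; exact hm hlt
    have hs := insertSign_square (t := t.erase l) (l := m) (m := l) (by simp [hm]) (by simp) hml
    rw [Finset.insert_erase hlt] at hs
    rw [if_pos (Finset.mem_insert_of_mem hlt), Finset.erase_insert_of_ne hml, smul_smul,
      ← add_smul, hs, zero_smul]
  · rw [KMod.contract_single e a h hk, if_neg hlt, map_zero, zero_add,
      Finset.sum_eq_single_of_mem l (Finset.mem_compl.2 hlt)]
    · rw [if_pos (Finset.mem_insert_self l t), Finset.erase_insert hlt, smul_smul,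
        insertSign_mul_self, one_smul]
    · intro m _ hml
      rw [if_neg (by simp [hml.symm, hlt]), smul_zero]

/-- `K_*` of a principal colouring that is not generated at `1` is acyclic. -/
lemma KComplex_principal_acyclic [OrderTop B] (hz : z ≠ ⊤) :
    (KComplex e (principal z M)).Acyclic := by
  obtain ⟨l, hl⟩ : ∃ l, l ∉ e z := by
    by_contra! h
    exact hz (e.injective (by rw [map_top]; exact Finset.eq_univ_of_forall h))
  exact ChainComplex.of_acyclic_of_contraction _ _
    (fun k => by rw [← ModuleCat.ofHom_comp, KMod.d_comp_d]; rfl)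
    (fun k => KMod.contract e z M l k)
    (fun x => LinearMap.congr_fun (KMod.d_contract_zero e hl) x)
    (fun k x => LinearMap.congr_fun (KMod.d_contract_succ e hl k) x) fun _ => map_zero _

end CubeContraction

/-! ### The quasi-isomorphisms -/

section QuasiIso

variable {R : Type v} [CommRing R]

lemma quasiIso_of_acyclic {K L : ChainComplex (ModuleCat.{w} R) ℕ} (f : K ⟶ L) (hK : K.Acyclic)
    (hL : L.Acyclic) : QuasiIso f := by
  rw [quasiIso_iff]
  exact fun n => (quasiIsoAt_iff_exactAt f n (hK n)).2 (hL n)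

variable {P : Type u} [PartialOrder P] [OrderTop P]

lemma principal_top_concentrated (M : ModuleCat.{w} R) (x : P) (hx : x ≠ ⊤) :
    Subsingleton ((principal (⊤ : P) M).obj x) :=
  principal_subsingleton (fun h => hx (top_le_iff.1 h)) M

/-- The inclusion `C_* ⊆ S_*` is a quasi-isomorphism for colourings of finite posets. -/
theorem incl_quasiIso [Finite P] (F : P ⥤ ModuleCat.{w} R) : QuasiIso (incl F) := by
  refine quasiIso_app_of_principal CFunctor_map_shortExact SFunctor_map_shortExact
    (inclNatTrans R) (fun z M => ?_) F
  by_cases hz : z = ⊤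
  · subst hz
    exact incl_quasiIso_of_concentrated _ (principal_top_concentrated M)
  · exact quasiIso_of_acyclic _ (CComplex_principal_acyclic hz) (SComplex_principal_acyclic hz)

/-- The map `φ` is a quasi-isomorphism. -/
theorem phiHom_quasiIso {r : ℕ} (e : P ≃o Finset (Fin r)) (F : P ⥤ ModuleCat.{w} R) :
    QuasiIso (phiHom e F) := by
  have := finite_of_iso e
  refine quasiIso_app_of_principal (KFunctor_map_shortExact e) CFunctor_map_shortExact
    (phiNatTrans e R) (fun z M => ?_) F
  by_cases hz : z = ⊤
  · subst hz
    exact phiHom_quasiIso_of_concentrated e _ (principal_top_concentrated M)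
  · exact quasiIso_of_acyclic _ (KComplex_principal_acyclic e hz) (CComplex_principal_acyclic hz)

end QuasiIso

end ColouredPoset

open ColouredPoset in
theorem theorem5p1 {R : Type v} [CommRing R] {B : Type u} [PartialOrder B] [OrderTop B] {r : ℕ}
    (e : B ≃o Finset (Fin r)) (F : B ⥤ ModuleCat.{w} R) :
    ∃ φ : KComplex e F ⟶ CComplex F,
      (∀ n, φ.f n = ModuleCat.ofHom (phi e F n)) ∧
      QuasiIso φ ∧
      ∀ n, ∃ i : cubeHomology e F n ≅ posetHomology F n,
        i.hom = HomologicalComplex.homologyMap (φ ≫ incl F) n := by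
  have := finite_of_iso e
  have h₁ := phiHom_quasiIso e F
  have h₂ := incl_quasiIso F
  exact ⟨phiHom e F, fun _ => rfl, h₁, fun n =>
    -- The composite of the quasi-isomorphisms `h₁` and `h₂` is again one, so its map on homology is
    -- invertible by instance search.
    ⟨asIso (HomologicalComplex.homologyMap (phiHom e F ≫ incl F) n), rfl⟩⟩
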